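/- Let $m$ indivisible items and $n$ agents be given. Agent $i$ has a binary additive valuation $v_i$ on sets of items: $v_i(\emptyset)=0$, $v_i(S)=\sum_{o\in S}v_i(\{o\})$, and $v_i(S\cup\{o\})-v_i(S)\in\{0,1\}$ for all $S,o$. An allocation is a family $\chi=(\chi_1,\dots,\chi_n)$ of pairwise disjoint sets of items (items may stay unallocated). Call $\chi$ admissible if it maximizes $\sum_i v_i(\chi_i)$ over all allocations and is clean, i.e. $v_i(\chi_i)-v_i(\chi_i\setminus\{o\})=1$ for all $i$ and $o\in\chi_i$. The profile of $\chi$ is $(h_1,\dots,h_n)$ with $h_i=|\chi_i|$. A criterion is a function $f$ from the profiles (vectors $h\in\mathbb{Z}_{\ge 0}^n$ with $\sum_i h_i\le m$) to $\mathbb{R}$ that is symmetric, i.e. invariant under permutations of the coordinates. It is strongly Pigou–Dalton if $f(q)<f(p)$ whenever there are $j,k$ with $p_j<p_k$, $q_j,q_k\in(p_j,p_k)$, $q_j+q_k=p_j+p_k$ and $q_i=p_i$ for all $i\notin\{j,k\}$. An admissible allocation is optimal under $f$ if its profile has the least value of $f$ among the profiles of all admissible allocations. For an allocation $\chi$, draw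 an edge $(i,j)$ between agents $i\ne j$ if some item $o\in\chi_i$ has $v_j(\{o\})=1$. An admissible allocation is stable if there is no simple path $(i_1,\dots,i_k)$, $k\ge 2$, along such edges with $h_{i_1}\ge h_{i_k}+2$ (a narrowing transfer). 1. For every (symmetric) strongly Pigou–Dalton criterion $f$, the admissible allocations that are optimal under $f$ are exactly the stable ones. 2. A stable allocation can be found in $O(m^2n)$ time: there is a program for the unit-cost word RAM with words of $O(\log(m+n))$ bits which, for all $m,n\ge 1$ and all binary additive valuations, given $m$, $n$ and the $0/1$ matrix $(v_i(\{o\}))_{o,i}$, halts after $O(m^2n)$ steps and outputs (for every item, the agent that receives it, or that none does) a stable allocation; this allocation minimizes $\mathrm{Congestion}=\sum_i\binom{h_i}{2}$ among all admissible allocations. -/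

import Mathlib

namespace FairAlloc

/-! ### Valuations -/

/-- The marginal gain of the item `o` over the bundle `S`. -/
def marginalGain {m : ℕ} (v : Finset (Fin m) → ℝ) (S : Finset (Fin m)) (o : Fin m) : ℝ :=
  v (insert o S) - v S

/-- A binary additive (0/1-add) valuation on bundles of the `m` items. -/
structure IsBinaryAdditive {m : ℕ} (v : Finset (Fin m) → ℝ) : Prop where
  empty : v ∅ = 0
  binary : ∀ (S : Finset (Fin m)) (o : Fin m), marginalGain v S o = 0 ∨ marginalGain v S o = 1
  additive : ∀ S : Finset (Fin m), v S = ∑ o ∈ S, v {o}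

/-! ### Allocations -/

/-- An allocation of `m` indivisible items to `n` agents: pairwise disjoint bundles
(items may stay unallocated). -/
structure Allocation (m n : ℕ) where
  bundle : Fin n → Finset (Fin m)
  disjoint : ∀ i j : Fin n, i ≠ j → Disjoint (bundle i) (bundle j)

/-- A bundle is clean if removing any of its items loses value one. -/
def IsCleanBundle {m : ℕ} (v : Finset (Fin m) → ℝ) (S : Finset (Fin m)) : Prop :=
  ∀ o ∈ S, marginalGain v (S.erase o) o = 1

def IsClean {m n : ℕ} (v : Fin n → Finset (Fin m) → ℝ) (χ : Allocation m n) : Prop :=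
  ∀ i, IsCleanBundle (v i) (χ.bundle i)

/-- Utilitarian social welfare. -/
def usw {m n : ℕ} (v : Fin n → Finset (Fin m) → ℝ) (χ : Allocation m n) : ℝ :=
  ∑ i, v i (χ.bundle i)

def IsMaxUSW {m n : ℕ} (v : Fin n → Finset (Fin m) → ℝ) (χ : Allocation m n) : Prop :=
  ∀ χ' : Allocation m n, usw v χ' ≤ usw v χ

/-- The allocations under consideration: clean and of maximal utilitarian social welfare. -/
def IsAdmissible {m n : ℕ} (v : Fin n → Finset (Fin m) → ℝ) (χ : Allocation m n) : Prop :=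
  IsMaxUSW v χ ∧ IsClean v χ

/-! ### Profiles and criteria -/

/-- Profiles of `m` items and `n` agents: vectors of numbers of received items. -/
def Profile (m n : ℕ) : Type := {h : Fin n → ℕ // ∑ i, h i ≤ m}

theorem Allocation.sum_card_le {m n : ℕ} (χ : Allocation m n) :
    ∑ i, (χ.bundle i).card ≤ m := by
  rw [← Finset.card_biUnion (fun i _ j _ hij => χ.disjoint i j hij)]
  exact (Finset.card_le_univ _).trans (by simp)

/-- The profile `(h_1, …, h_n)` with `h_i` the number of items of agent `i`. -/
def Allocation.profile {m n : ℕ} (χ : Allocation m n) : Profile m n :=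
  ⟨fun i => (χ.bundle i).card, χ.sum_card_le⟩

/-- A criterion (lower is better) takes the same value at all permutations of a profile. -/
def IsSymmetricCriterion {m n : ℕ} (f : Profile m n → ℝ) : Prop :=
  ∀ (σ : Equiv.Perm (Fin n)) (p q : Profile m n), (∀ i, q.1 i = p.1 (σ i)) → f q = f p

/-- `MoreBalanced q p`: the profile `q` arises from `p` by a transfer of income between two
agents `j` and `k` that moves both incomes strictly between the two old ones. -/
def MoreBalanced {m n : ℕ} (q p : Profile m n) : Prop :=
  ∃ j k : Fin n, p.1 j < p.1 k ∧ q.1 j ∈ Set.Ioo (p.1 j) (p.1 k) ∧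
    q.1 k ∈ Set.Ioo (p.1 j) (p.1 k) ∧ q.1 j + q.1 k = p.1 j + p.1 k ∧
    ∀ i, i ≠ j → i ≠ k → q.1 i = p.1 i

/-- Strongly Pigou–Dalton criteria. -/
def IsSPD {m n : ℕ} (f : Profile m n → ℝ) : Prop :=
  ∀ p q : Profile m n, MoreBalanced q p → f q < f p

/-- `χ` is optimal under `f` among the clean allocations of maximal welfare. -/
def IsOptimal {m n : ℕ} (v : Fin n → Finset (Fin m) → ℝ) (f : Profile m n → ℝ)
    (χ : Allocation m n) : Prop :=
  IsAdmissible v χ ∧ ∀ χ' : Allocation m n, IsAdmissible v χ' → f χ.profile ≤ f χ'.profile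

/-- The criterion `∑ i, h_i (h_i - 1) / 2`. -/
def congestion {m n : ℕ} (p : Profile m n) : ℝ := ∑ i, ((p.1 i).choose 2 : ℝ)

/-! ### Transfers and stability -/

/-- Some item of agent `i` can be reallocated to another agent `j`. -/
def Edge {m n : ℕ} (v : Fin n → Finset (Fin m) → ℝ) (χ : Allocation m n) (i j : Fin n) : Prop :=
  i ≠ j ∧ ∃ o ∈ χ.bundle i, v j {o} = 1

/-- There is a simple path `(i_1, …, i_k)`, `k ≥ 2`, of edges from `u = i_1` to `w = i_k`. -/
def HasTransfer {m n : ℕ} (v : Fin n → Finset (Fin m) → ℝ) (χ : Allocation m n)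
    (u w : Fin n) : Prop :=
  ∃ l : List (Fin n), 2 ≤ l.length ∧ l.Nodup ∧ l.IsChain (Edge v χ) ∧
    l.head? = some u ∧ l.getLast? = some w

def HasNarrowingTransfer {m n : ℕ} (v : Fin n → Finset (Fin m) → ℝ)
    (χ : Allocation m n) : Prop :=
  ∃ u w : Fin n, HasTransfer v χ u w ∧ (χ.bundle w).card + 2 ≤ (χ.bundle u).card

/-- Stable allocations: admissible ones without a narrowing transfer. -/
def IsStable {m n : ℕ} (v : Fin n → Finset (Fin m) → ℝ) (χ : Allocation m n) : Prop :=
  IsAdmissible v χ ∧ ¬ HasNarrowingTransfer v χ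

/-! ### A word RAM with structured programs and unit-cost instructions -/

/-- Machine states: registers, and arrays of words (array `a`, index `k`). -/
structure State where
  reg : ℕ → ℕ
  arr : ℕ → ℕ → ℕ

def State.setReg (s : State) (x value : ℕ) : State :=
  { s with reg := Function.update s.reg x value }

def State.setArr (s : State) (a k value : ℕ) : State :=
  { s with arr := Function.update s.arr a (Function.update (s.arr a) k value) }

/-- Programs. Names of registers (`x y z`) and of arrays (`a`) are fixed in the program text. -/
inductive Prog where
  | skip : Prog
  /-- `x := k` -/
  | const (x k : ℕ) : Prog
  /-- `x := y` -/
  | copy (x y : ℕ) : Prog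
  /-- `x := y + z` -/
  | add (x y z : ℕ) : Prog
  /-- `x := max (y - z) 0` -/
  | sub (x y z : ℕ) : Prog
  /-- `x := y * z` -/
  | mul (x y z : ℕ) : Prog
  /-- `x := a[y]` -/
  | load (x a y : ℕ) : Prog
  /-- `a[x] := y` -/
  | store (a x y : ℕ) : Prog
  | seq (p q : Prog) : Prog
  /-- `if x < y then p else q` -/
  | ifLt (x y : ℕ) (p q : Prog) : Prog
  /-- `while x < y do p` -/
  | whileLt (x y : ℕ) (p : Prog) : Prog

/-- `Exec W p s t s'`: on a machine whose words hold the numbers below `W`, the program `p`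
started in state `s` halts in state `s'` after exactly `t` steps. Every instruction and every
evaluation of a test is one step. A computation in which a constant, sum or product does not
fit into a word is stuck: it has no execution. -/
inductive Exec (W : ℕ) : Prog → State → ℕ → State → Prop where
  | skip (s : State) : Exec W .skip s 1 s
  | const (x k : ℕ) (s : State) (h : k < W) : Exec W (.const x k) s 1 (s.setReg x k)
  | copy (x y : ℕ) (s : State) : Exec W (.copy x y) s 1 (s.setReg x (s.reg y))
  | add (x y z : ℕ) (s : State) (h : s.reg y + s.reg z < W) :
      Exec W (.add x y z) s 1 (s.setReg x (s.reg y + s.reg z))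
  | sub (x y z : ℕ) (s : State) :
      Exec W (.sub x y z) s 1 (s.setReg x (s.reg y - s.reg z))
  | mul (x y z : ℕ) (s : State) (h : s.reg y * s.reg z < W) :
      Exec W (.mul x y z) s 1 (s.setReg x (s.reg y * s.reg z))
  | load (x a y : ℕ) (s : State) :
      Exec W (.load x a y) s 1 (s.setReg x (s.arr a (s.reg y)))
  | store (a x y : ℕ) (s : State) :
      Exec W (.store a x y) s 1 (s.setArr a (s.reg x) (s.reg y))
  | seq {p q : Prog} {s s' s'' : State} {t t' : ℕ} (hp : Exec W p s t s')
      (hq : Exec W q s' t' s'') : Exec W (.seq p q) s (t + t') s''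
  | ifTrue {x y : ℕ} {p q : Prog} {s s' : State} {t : ℕ} (h : s.reg x < s.reg y)
      (hp : Exec W p s t s') : Exec W (.ifLt x y p q) s (t + 1) s'
  | ifFalse {x y : ℕ} {p q : Prog} {s s' : State} {t : ℕ} (h : ¬ s.reg x < s.reg y)
      (hq : Exec W q s t s') : Exec W (.ifLt x y p q) s (t + 1) s'
  | whileTrue {x y : ℕ} {p : Prog} {s s' s'' : State} {t t' : ℕ} (h : s.reg x < s.reg y)
      (hp : Exec W p s t s') (hw : Exec W (.whileLt x y p) s' t' s'') :
      Exec W (.whileLt x y p) s (t + t' + 1) s''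
  | whileFalse {x y : ℕ} {p : Prog} {s : State} (h : ¬ s.reg x < s.reg y) :
      Exec W (.whileLt x y p) s 1 s

open Classical in
/-- The input: `m` and `n` in registers 0 and 1, and in array 0 the 0/1 matrix of the values
`v_i({o})`, the entry of item `o` and agent `i` at index `o * n + i`. All else is zero. -/
noncomputable def inputState {m n : ℕ} (v : Fin n → Finset (Fin m) → ℝ) : State where
  reg := fun x => if x = 0 then m else if x = 1 then n else 0
  arr := fun a k =>
    if a = 0 ∧ ∃ (o : Fin m) (i : Fin n), k = (o : ℕ) * n + i ∧ v i {o} = 1 then 1 else 0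

/-- The output: array 1 holds at index `o` the number `i + 1` if item `o` is allocated to
agent `i` (agents being numbered from 0), and `0` if item `o` is unallocated. -/
def Outputs {m n : ℕ} (s : State) (χ : Allocation m n) : Prop :=
  ∀ o : Fin m, (∀ i : Fin n, o ∈ χ.bundle i → s.arr 1 o = i + 1) ∧
    ((∀ i : Fin n, o ∉ χ.bundle i) → s.arr 1 o = 0)

end FairAlloc

namespace FairAlloc

/-! Welfare is a sum over items, so an allocation is admissible iff every held item is valued by its
holder and every item valued by somebody is held (`isAdmissible_iff`).

The first claim rests on cut certificates (`HasCuts`). If no narrowing transfer exists, the agents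
reachable from those with more than `t` items form a cut `R`. Items held in `R` are valued only
inside `R`, so every admissible allocation must place them there. Hence a stable allocation
minimizes `∑ (h_i - t)⁺` for all `t` simultaneously (`HasCuts.sum_tsub_le`). These sums determine a
profile up to permutation (`exists_perm_of_sum_tsub_eq`), so all stable allocations have the same
value under a symmetric criterion. An optimal allocation is stable, since carrying out a narrowing
transfer (`exists_transfer`) would give a more balanced admissible profile. By finiteness an optimum
exists; it is stable, so every stable allocation shares its value.

For the second claim, items are inserted one at a time. A virtual agent 0 holds the unassigned
items, and a breadth-first search from it finds all agents that could gain an item. A least loaded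
visited agent `w` receives one, by moving items along its tree path. Cuts survive
(`PathShift.partialStable`): up to the load of `w` the visited agents are added to the old cut, and
above it the old cut avoids `w` and still works. A search runs once through the items for each
visited agent, but through the agents only once per item, because an item has one owner. So an
insertion costs `O(mn)`. Time and correctness are proved together by `Run`, with loop invariants
indexed by a bound on the remaining time. -/

variable {m n : ℕ} {v : Fin n → Finset (Fin m) → ℝ}

/-! ### Admissibility, item by item -/

theorem IsBinaryAdditive.singleton {u : Finset (Fin m) → ℝ} (hu : IsBinaryAdditive u)
    (o : Fin m) : u {o} = 0 ∨ u {o} = 1 := by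
  have h := hu.binary ∅ o
  simpa [marginalGain, hu.empty] using h

theorem IsBinaryAdditive.marginalGain_erase {u : Finset (Fin m) → ℝ} (hu : IsBinaryAdditive u)
    {S : Finset (Fin m)} {o : Fin m} (ho : o ∈ S) : marginalGain u (S.erase o) o = u {o} := by
  rw [marginalGain, Finset.insert_erase ho, hu.additive S, hu.additive (S.erase o),
    ← Finset.add_sum_erase S _ ho]
  ring

theorem isClean_iff (hv : ∀ i, IsBinaryAdditive (v i)) (χ : Allocation m n) :
    IsClean v χ ↔ ∀ i, ∀ o ∈ χ.bundle i, v i {o} = 1 := by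
  refine forall_congr' fun i => forall₂_congr fun o ho => ?_
  rw [(hv i).marginalGain_erase ho]

theorem Allocation.owner_unique (χ : Allocation m n) {i j : Fin n} {o : Fin m}
    (hi : o ∈ χ.bundle i) (hj : o ∈ χ.bundle j) : i = j := by
  by_contra h
  exact Finset.disjoint_left.1 (χ.disjoint i j h) hi hj

/-- Exchanging the sums charges welfare to items. By disjointness at most one inner term survives,
see `Allocation.sum_owner`. -/
theorem usw_eq_sum (hv : ∀ i, IsBinaryAdditive (v i)) (χ : Allocation m n) :
    usw v χ = ∑ o, ∑ i, if o ∈ χ.bundle i then v i {o} else 0 := by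
  rw [usw, Finset.sum_comm]
  refine Finset.sum_congr rfl fun i _ => ?_
  rw [(hv i).additive, ← Finset.sum_filter]
  simp

theorem Allocation.sum_owner (χ : Allocation m n) {i : Fin n} {o : Fin m} (hi : o ∈ χ.bundle i) :
    (∑ j, if o ∈ χ.bundle j then v j {o} else 0) = v i {o} := by
  rw [Finset.sum_eq_single i]
  · simp [hi]
  · intro j _ hj
    rw [if_neg]
    exact fun h => hj (χ.owner_unique h hi)
  · simp

/-- Give the item `o` to agent `x`. -/
def Allocation.give (χ : Allocation m n) (o : Fin m) (x : Fin n) : Allocation m n where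
  bundle i := if i = x then insert o (χ.bundle i) else (χ.bundle i).erase o
  disjoint i j hij := by
    rw [Finset.disjoint_left]
    intro a hi hj
    have key : ¬ (a ∈ χ.bundle i ∧ a ∈ χ.bundle j) := fun h => hij (χ.owner_unique h.1 h.2)
    split_ifs at hi hj with h1 h2 h2 <;> simp only [Finset.mem_insert, Finset.mem_erase] at hi hj
    · exact hij (h1.trans h2.symm)
    · tauto
    · tauto
    · tauto

theorem Allocation.mem_give {χ : Allocation m n} {o a : Fin m} {x i : Fin n} :
    a ∈ (χ.give o x).bundle i ↔ (a = o ∧ i = x) ∨ (a ≠ o ∧ a ∈ χ.bundle i) := by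
  unfold Allocation.give
  by_cases h : i = x <;> by_cases h' : a = o <;> simp [h, h']

/-- Handing over an unallocated item to somebody who values it gains one. Conversely, an item
contributes at most one to any welfare, and under the stated conditions it contributes one as soon
as anybody values it. -/
theorem isAdmissible_iff (hv : ∀ i, IsBinaryAdditive (v i)) (χ : Allocation m n) :
    IsAdmissible v χ ↔ (∀ i, ∀ o ∈ χ.bundle i, v i {o} = 1) ∧
      ∀ o i, v i {o} = 1 → ∃ j, o ∈ χ.bundle j := by
  constructor
  · rintro ⟨hmax, hclean⟩
    rw [isClean_iff hv] at hclean
    refine ⟨hclean, fun o i hoi => ?_⟩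
    by_contra! hno
    have h := hmax (χ.give o i)
    rw [usw_eq_sum hv, usw_eq_sum hv] at h
    refine absurd h (not_le.2 (Finset.sum_lt_sum (fun a _ => ?_) ⟨o, Finset.mem_univ _, ?_⟩))
    · by_cases ha : a = o
      · subst ha
        rw [(χ.give _ i).sum_owner (Allocation.mem_give.2 (Or.inl ⟨rfl, rfl⟩)), hoi]
        simp [hno]
      · simp [Allocation.mem_give, ha]
    · rw [(χ.give _ i).sum_owner (Allocation.mem_give.2 (Or.inl ⟨rfl, rfl⟩)), hoi]
      simp [hno]
  · rintro ⟨hclean, hall⟩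
    refine ⟨fun χ' => ?_, (isClean_iff hv χ).2 hclean⟩
    rw [usw_eq_sum hv, usw_eq_sum hv]
    refine Finset.sum_le_sum fun o _ => ?_
    have hnn : 0 ≤ ∑ i, if o ∈ χ.bundle i then v i {o} else 0 := by
      refine Finset.sum_nonneg fun i _ => ?_
      split_ifs with h
      · rw [hclean i o h]; exact zero_le_one
      · exact le_rfl
    by_cases h' : ∃ i, o ∈ χ'.bundle i
    · obtain ⟨i, hi⟩ := h'
      rw [χ'.sum_owner hi]
      rcases (hv i).singleton o with h0 | h1
      · rw [h0]; exact hnn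
      · obtain ⟨j, hj⟩ := hall o i h1
        rw [χ.sum_owner hj, h1, hclean j o hj]
    · push Not at h'
      simpa [h'] using hnn

/-! ### Transfers along paths -/

theorem IsAdmissible.give (hv : ∀ i, IsBinaryAdditive (v i)) {χ : Allocation m n}
    (hχ : IsAdmissible v χ) {o : Fin m} {x : Fin n} (hx : v x {o} = 1) :
    IsAdmissible v (χ.give o x) := by
  rw [isAdmissible_iff hv] at hχ ⊢
  refine ⟨fun i a ha => ?_, fun a i hai => ?_⟩
  · rcases Allocation.mem_give.1 ha with ⟨rfl, rfl⟩ | ⟨_, h⟩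
    · exact hx
    · exact hχ.1 i a h
  · by_cases h : a = o
    · exact ⟨x, Allocation.mem_give.2 (Or.inl ⟨h, rfl⟩)⟩
    · obtain ⟨j, hj⟩ := hχ.2 a i hai
      exact ⟨j, Allocation.mem_give.2 (Or.inr ⟨h, hj⟩)⟩

theorem Allocation.card_give {χ : Allocation m n} {o : Fin m} {u x : Fin n} (hux : u ≠ x)
    (ho : o ∈ χ.bundle u) :
    ((χ.give o x).bundle u).card + 1 = (χ.bundle u).card ∧
      ((χ.give o x).bundle x).card = (χ.bundle x).card + 1 ∧
      ∀ i, i ≠ u → (χ.give o x).bundle i = if i = x then insert o (χ.bundle x) else χ.bundle i := by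
  have hnot : ∀ i, i ≠ u → o ∉ χ.bundle i := fun i hi h => hi (χ.owner_unique h ho)
  refine ⟨?_, ?_, fun i hi => ?_⟩
  · simp only [Allocation.give, if_neg hux]
    exact Finset.card_erase_add_one ho
  · simp only [Allocation.give, if_true]
    exact Finset.card_insert_of_notMem (hnot x hux.symm)
  · by_cases h : i = x
    · simp [Allocation.give, h]
    · simp [Allocation.give, h, Finset.erase_eq_of_notMem (hnot i hi)]

/-- The first item is handed over and induction treats the rest of the path. The remaining edges
survive because only `u` loses an item, and `u` does not occur again on a simple path. -/
theorem exists_transfer (hv : ∀ i, IsBinaryAdditive (v i)) (w : Fin n) :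
    ∀ (l : List (Fin n)) (u : Fin n) (χ : Allocation m n), IsAdmissible v χ → (u :: l).Nodup →
      (u :: l).IsChain (Edge v χ) → (u :: l).getLast? = some w → u ≠ w →
      ∃ χ' : Allocation m n, IsAdmissible v χ' ∧
        (χ'.bundle u).card + 1 = (χ.bundle u).card ∧
        (χ'.bundle w).card = (χ.bundle w).card + 1 ∧
        ∀ i, i ≠ u → i ≠ w → (χ'.bundle i).card = (χ.bundle i).card := by
  intro l
  induction l with
  | nil =>
    intro u χ _ _ _ hlast huw
    simp at hlast
    exact absurd hlast huw
  | cons x l ih =>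
    intro u χ hχ hnd hch hlast huw
    rw [List.isChain_cons_cons] at hch
    obtain ⟨⟨hux, o, ho, hxo⟩, hch⟩ := hch
    rw [List.nodup_cons] at hnd
    obtain ⟨hu, hnd⟩ := hnd
    have hχ' := hχ.give hv hxo
    obtain ⟨c1, c2, c3⟩ := Allocation.card_give hux ho
    by_cases hxw : x = w
    · subst hxw
      refine ⟨_, hχ', c1, c2, fun i hi hix => ?_⟩
      rw [c3 i hi, if_neg hix]
    · have hch' : (x :: l).IsChain (Edge v (χ.give o x)) := by
        refine List.IsChain.imp_of_mem_imp (R := Edge v χ) ?_ hch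
        rintro a b ha - ⟨hab, p, hp, hbp⟩
        refine ⟨hab, p, ?_, hbp⟩
        rw [c3 a (fun h => hu (h ▸ ha))]
        split_ifs with h
        · subst h; exact Finset.mem_insert_of_mem hp
        · exact hp
      rw [List.getLast?_cons_cons] at hlast
      obtain ⟨χ', h1, h2, h3, h4⟩ := ih x _ hχ' hnd hch' hlast hxw
      refine ⟨χ', h1, ?_, ?_, fun i hiu hiw => ?_⟩
      · rw [h4 u hux huw, c1]
      · rw [h3, c3 w huw.symm, if_neg (Ne.symm hxw)]
      · by_cases hix : i = x
        · subst hix; omega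
        · rw [h4 i hix hiw, c3 i hiu, if_neg hix]

/-- When the new first vertex already lies on the simple path found so far, the path is cut back to
start at that occurrence. -/
theorem exists_simple_path {α : Type*} {r : α → α → Prop} {u w : α}
    (h : Relation.ReflTransGen r u w) :
    ∃ l : List α, (u :: l).Nodup ∧ (u :: l).IsChain r ∧ (u :: l).getLast? = some w := by
  classical
  induction h using Relation.ReflTransGen.head_induction_on with
  | refl => exact ⟨[], by simp⟩
  | head hab _ ih =>
    rename_i a b _
    obtain ⟨l, hnd, hch, hlast⟩ := ih
    by_cases ha : a ∈ b :: l
    · obtain ⟨l₁, l₂, hl⟩ := List.append_of_mem ha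
      rw [hl] at hnd hch hlast
      refine ⟨l₂, (List.nodup_append.1 hnd).2.1, (List.isChain_append.1 hch).2.1, ?_⟩
      simpa using hlast
    · refine ⟨b :: l, List.nodup_cons.2 ⟨ha, hnd⟩, List.isChain_cons_cons.2 ⟨hab, hch⟩, ?_⟩
      simpa using hlast

/-! ### Stability as existence of cuts -/

/-- For every threshold `t` there is a set of agents that contains the agents with more than `t`
items, whose members have at least `t` items, and whose items nobody else values. -/
def HasCuts (v : Fin n → Finset (Fin m) → ℝ) (χ : Allocation m n) : Prop :=
  ∀ t : ℕ, ∃ R : Finset (Fin n), (∀ i, t + 1 ≤ (χ.bundle i).card → i ∈ R) ∧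
    (∀ i ∈ R, t ≤ (χ.bundle i).card) ∧ ∀ i ∈ R, ∀ o ∈ χ.bundle i, ∀ j, v j {o} = 1 → j ∈ R

theorem HasCuts.not_hasNarrowingTransfer {χ : Allocation m n} (h : HasCuts v χ) :
    ¬ HasNarrowingTransfer v χ := by
  rintro ⟨u, w, ⟨l, -, -, hch, hu, hw⟩, huw⟩
  -- At this threshold `u` is forced into `R`, closure carries membership to `w`, and `w` has one
  -- item too few to be a member.
  obtain ⟨R, h1, h2, h3⟩ := h ((χ.bundle w).card + 1)
  have key : ∀ (l : List (Fin n)) (u : Fin n), u ∈ R → l.IsChain (Edge v χ) →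
      l.head? = some u → l.getLast? = some w → w ∈ R := by
    intro l
    induction l with
    | nil => intro u _ _ hu; simp at hu
    | cons a l ih =>
      intro u huR hch hu hw
      simp only [List.head?_cons, Option.some.injEq] at hu
      subst hu
      cases l with
      | nil => simp at hw; rwa [← hw]
      | cons b l =>
        rw [List.isChain_cons_cons] at hch
        obtain ⟨⟨-, o, ho, hb⟩, hch⟩ := hch
        exact ih b (h3 a huR o ho b hb) hch rfl (by simpa using hw)
  have := h2 w (key l u (h1 u (by omega)) hch hu hw)
  omega

/-- The cut consists of everything reachable from agents with more than `t` items. A member with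
fewer than `t` items would be the end of a narrowing transfer. -/
theorem hasCuts_of_not_hasNarrowingTransfer {χ : Allocation m n}
    (h : ¬ HasNarrowingTransfer v χ) : HasCuts v χ := by
  classical
  intro t
  refine ⟨Finset.univ.filter fun i => ∃ u, t + 1 ≤ (χ.bundle u).card ∧
    Relation.ReflTransGen (Edge v χ) u i, fun i hi => ?_, fun i hi => ?_, fun i hi o ho j hj => ?_⟩
  · exact Finset.mem_filter.2 ⟨Finset.mem_univ _, i, hi, Relation.ReflTransGen.refl⟩
  · obtain ⟨-, u, hu, hui⟩ := Finset.mem_filter.1 hi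
    by_contra hlt
    have hne : u ≠ i := by rintro rfl; omega
    obtain ⟨l, hnd, hch, hlast⟩ := exists_simple_path hui
    refine h ⟨u, i, ⟨u :: l, ?_, hnd, hch, rfl, hlast⟩, by omega⟩
    cases l with
    | nil => simp at hlast; exact absurd hlast hne
    | cons => simp
  · by_cases hij : i = j
    · exact hij ▸ hi
    · obtain ⟨-, u, hu, hui⟩ := Finset.mem_filter.1 hi
      exact Finset.mem_filter.2 ⟨Finset.mem_univ _, u, hu, hui.tail ⟨hij, o, ho, hj⟩⟩

/-- On the cut for `t` the truncation in `χ` is exact, and outside it vanishes. The items of the cut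
stay in the cut under `χ'`, so the total there cannot drop. -/
theorem HasCuts.sum_tsub_le (hv : ∀ i, IsBinaryAdditive (v i)) {χ χ' : Allocation m n}
    (hχ : IsAdmissible v χ) (hc : HasCuts v χ) (hχ' : IsAdmissible v χ') (t : ℕ) :
    ∑ i, ((χ.bundle i).card - t) ≤ ∑ i, ((χ'.bundle i).card - t) := by
  obtain ⟨R, h1, h2, h3⟩ := hc t
  rw [isAdmissible_iff hv] at hχ hχ'
  have hsub : R.biUnion χ.bundle ⊆ R.biUnion χ'.bundle := by
    intro o ho
    obtain ⟨i, hi, hoi⟩ := Finset.mem_biUnion.1 ho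
    obtain ⟨j, hj⟩ := hχ'.2 o i (hχ.1 i o hoi)
    exact Finset.mem_biUnion.2 ⟨j, h3 i hi o hoi j (hχ'.1 j o hj), hj⟩
  have hcard := Finset.card_le_card hsub
  rw [Finset.card_biUnion (fun i _ j _ hij => χ.disjoint i j hij),
    Finset.card_biUnion (fun i _ j _ hij => χ'.disjoint i j hij)] at hcard
  have e1 : ∑ i, ((χ.bundle i).card - t) = ∑ i ∈ R, ((χ.bundle i).card - t) := by
    refine (Finset.sum_subset (Finset.subset_univ R) fun i _ hi => ?_).symm
    by_contra hne
    exact hi (h1 i (by omega))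
  have e2 : ∑ i ∈ R, ((χ.bundle i).card - t) + R.card * t = ∑ i ∈ R, (χ.bundle i).card := by
    rw [← smul_eq_mul, ← Finset.sum_const, ← Finset.sum_add_distrib]
    exact Finset.sum_congr rfl fun i hi => Nat.sub_add_cancel (h2 i hi)
  have e3 : ∑ i ∈ R, (χ'.bundle i).card ≤ ∑ i ∈ R, ((χ'.bundle i).card - t) + R.card * t := by
    rw [← smul_eq_mul, ← Finset.sum_const, ← Finset.sum_add_distrib]
    exact Finset.sum_le_sum fun i _ => le_tsub_add
  have e4 : ∑ i ∈ R, ((χ'.bundle i).card - t) ≤ ∑ i, ((χ'.bundle i).card - t) :=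
    Finset.sum_le_sum_of_subset (Finset.subset_univ R)
  omega

/-- First differences in `t` count the indices with value at least `t + 1`, and second differences
count the fibers. Fibers of equal size are matched by bijections. -/
theorem exists_perm_of_sum_tsub_eq {ι : Type*} [Fintype ι] {a b : ι → ℕ}
    (h : ∀ t : ℕ, ∑ i, (a i - t) = ∑ i, (b i - t)) : ∃ σ : Equiv.Perm ι, ∀ i, a i = b (σ i) := by
  classical
  have step : ∀ (c : ι → ℕ) (t : ℕ), ∑ i, (c i - t) =
      ∑ i, (c i - (t + 1)) + (Finset.univ.filter fun i => t + 1 ≤ c i).card := by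
    intro c t
    rw [Finset.card_filter, ← Finset.sum_add_distrib]
    refine Finset.sum_congr rfl fun i _ => ?_
    split_ifs <;> omega
  have hge : ∀ t : ℕ, (Finset.univ.filter fun i => t ≤ a i).card =
      (Finset.univ.filter fun i => t ≤ b i).card := by
    rintro (_ | t)
    · simp
    · have := step a t
      have := step b t
      have := h t
      have := h (t + 1)
      omega
  have split : ∀ (c : ι → ℕ) (t : ℕ), (Finset.univ.filter fun i => t ≤ c i).card =
      (Finset.univ.filter fun i => t = c i).card +
        (Finset.univ.filter fun i => t + 1 ≤ c i).card := by
    intro c t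
    simp only [Finset.card_filter]
    rw [← Finset.sum_add_distrib]
    refine Finset.sum_congr rfl fun i _ => ?_
    split_ifs <;> omega
  have hfib : ∀ t : ℕ, Nonempty ({i // a i = t} ≃ {i // b i = t}) := by
    intro t
    rw [← Fintype.card_eq, Fintype.card_subtype, Fintype.card_subtype]
    have := hge t
    have := hge (t + 1)
    have := split a t
    have := split b t
    simp only [eq_comm (b := t)]
    omega
  exact ⟨Equiv.ofFiberEquiv fun t => (hfib t).some, fun i => (Equiv.ofFiberEquiv_map _ i).symm⟩

/-! ### Optimal means stable -/

theorem IsStable.value_eq (hv : ∀ i, IsBinaryAdditive (v i)) {f : Profile m n → ℝ}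
    (hf : IsSymmetricCriterion f) {χ χ' : Allocation m n} (h : IsStable v χ)
    (h' : IsStable v χ') : f χ.profile = f χ'.profile := by
  obtain ⟨σ, hσ⟩ := exists_perm_of_sum_tsub_eq
    (a := fun i => (χ.bundle i).card) (b := fun i => (χ'.bundle i).card) fun t =>
    le_antisymm ((hasCuts_of_not_hasNarrowingTransfer h.2).sum_tsub_le hv h.1 h'.1 t)
      ((hasCuts_of_not_hasNarrowingTransfer h'.2).sum_tsub_le hv h'.1 h.1 t)
  exact hf σ _ _ hσ

theorem IsOptimal.isStable (hv : ∀ i, IsBinaryAdditive (v i)) {f : Profile m n → ℝ}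
    (hf : IsSPD f) {χ : Allocation m n} (h : IsOptimal v f χ) : IsStable v χ := by
  refine ⟨h.1, ?_⟩
  rintro ⟨u, w, ⟨l, -, hnd, hch, hu, hw⟩, huw⟩
  cases l with
  | nil => simp at hu
  | cons a l =>
    simp only [List.head?_cons, Option.some.injEq] at hu
    subst hu
    have hne : a ≠ w := by rintro rfl; omega
    obtain ⟨χ', h1, h2, h3, h4⟩ := exists_transfer hv w l a χ h.1 hnd hch hw hne
    refine absurd (h.2 χ' h1) (not_le.2 (hf _ _ ⟨w, a, ?_, ⟨?_, ?_⟩, ⟨?_, ?_⟩, ?_, ?_⟩))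
    all_goals simp only [Allocation.profile]
    · omega
    · omega
    · omega
    · omega
    · omega
    · omega
    · exact fun i hiw hia => h4 i hia hiw

/-- Finiteness supplies an optimal allocation with which any stable one can be compared. -/
instance : Finite (Allocation m n) :=
  Finite.of_injective (fun χ : Allocation m n => χ.bundle) fun χ χ' h => by
    cases χ; cases χ'; cases h; rfl

theorem isOptimal_iff_isStable (hv : ∀ i, IsBinaryAdditive (v i)) {f : Profile m n → ℝ}
    (hsymm : IsSymmetricCriterion f) (hspd : IsSPD f) (χ : Allocation m n) :
    IsOptimal v f χ ↔ IsStable v χ := by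
  refine ⟨IsOptimal.isStable hv hspd, fun h => ⟨h.1, fun χ' hχ' => ?_⟩⟩
  obtain ⟨χ₀, h0, hmin⟩ := Set.exists_min_image {χ : Allocation m n | IsAdmissible v χ}
    (fun χ => f χ.profile) (Set.toFinite _) ⟨χ, h.1⟩
  have hopt : IsOptimal v f χ₀ := ⟨h0, hmin⟩
  rw [h.value_eq hv hsymm (hopt.isStable hv hspd)]
  exact hmin χ' hχ'

/-! ### Congestion -/

theorem isSymmetricCriterion_congestion :
    IsSymmetricCriterion (congestion : Profile m n → ℝ) := by
  intro σ p q h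
  simp only [congestion, h]
  exact Equiv.sum_comp σ fun i => ((p.1 i).choose 2 : ℝ)

theorem isSPD_congestion : IsSPD (congestion : Profile m n → ℝ) := by
  rintro p q ⟨j, k, hjk, ⟨hj1, hj2⟩, ⟨hk1, hk2⟩, hsum, hrest⟩
  have hne : j ≠ k := by rintro rfl; omega
  rw [← sub_pos, congestion, congestion, ← Finset.sum_sub_distrib,
    Finset.sum_eq_add j k hne (fun i _ hi => by rw [hrest i hi.1 hi.2, sub_self]) (by simp)
      (by simp)]
  simp only [Nat.cast_choose_two]
  have hs : (q.1 j : ℝ) + q.1 k = p.1 j + p.1 k := by exact_mod_cast hsum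
  have h1 : (p.1 j : ℝ) < q.1 j := by exact_mod_cast hj1
  have h2 : (p.1 j : ℝ) < q.1 k := by exact_mod_cast hk1
  have e : (p.1 k : ℝ) = q.1 j + q.1 k - p.1 j := by linarith
  rw [e]
  -- With the sum of the two incomes fixed, the decrease equals `(q_j - p_j) * (q_k - p_j)`.
  nlinarith [mul_pos (sub_pos.2 h1) (sub_pos.2 h2)]

/-! ### Inserting one item -/

/-- The number of items below `m` that `g` assigns to `j`. -/
def loadOf (m : ℕ) (g : ℕ → ℕ) (j : ℕ) : ℕ := ((Finset.range m).filter fun q => g q = j).card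

/-- The set `R` of agents contains everybody who values an item owned by a member. -/
def ClosedUnder (E : ℕ → ℕ → Prop) (g : ℕ → ℕ) (R : Set ℕ) : Prop :=
  ∀ q, g q ∈ R → ∀ j, E q j → j ∈ R

/-- `g` assigns to each item an agent (numbered from 1) or `0`; all items below `k` that are
valued by somebody are assigned, those from `k` on are not, and there are cuts for all
thresholds. `E q j` says that agent `j` values item `q`. -/
structure PartialStable (m : ℕ) (E : ℕ → ℕ → Prop) (k : ℕ) (g : ℕ → ℕ) : Prop where
  clean : ∀ q, g q ≠ 0 → E q (g q)
  lt : ∀ q, g q ≠ 0 → q < k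
  full : ∀ q, q < k → g q = 0 → ∀ j, ¬ E q j
  cut : ∀ t, ∃ R : Set ℕ, (∀ j, j ≠ 0 → t + 1 ≤ loadOf m g j → j ∈ R) ∧
    (∀ j ∈ R, j ≠ 0 ∧ t ≤ loadOf m g j) ∧ ClosedUnder E g R

theorem partialStable_zero (m : ℕ) (E : ℕ → ℕ → Prop) : PartialStable m E 0 fun _ => 0 where
  clean _ h := absurd rfl h
  lt _ h := absurd rfl h
  full _ h := absurd h (Nat.not_lt_zero _)
  cut t := by
    refine ⟨∅, fun j hj h => ?_, by simp, fun q h => by simp at h⟩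
    simp [loadOf, hj.symm] at h

theorem loadOf_le {m k : ℕ} {g : ℕ → ℕ} (h : ∀ q, g q ≠ 0 → q < k) {j : ℕ} (hj : j ≠ 0) :
    loadOf m g j ≤ k := by
  rw [← Finset.card_range k]
  refine Finset.card_le_card fun q hq => ?_
  rw [Finset.mem_filter] at hq
  exact Finset.mem_range.2 (h q (hq.2 ▸ hj))

/-- Loss and gain stand on opposite sides, which avoids truncated subtraction and covers `c = g p`.
-/
theorem loadOf_update {m p : ℕ} (hp : p < m) (g : ℕ → ℕ) (c j : ℕ) :
    loadOf m (Function.update g p c) j + (if j = g p then 1 else 0) =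
      loadOf m g j + if j = c then 1 else 0 := by
  have hmem := Finset.mem_range.2 hp
  simp only [loadOf, Finset.card_filter]
  rw [← Finset.add_sum_erase _ _ hmem, ← Finset.add_sum_erase _ (fun q => if g q = j then 1 else 0) hmem]
  have : ∑ q ∈ (Finset.range m).erase p, (if Function.update g p c q = j then 1 else 0) =
      ∑ q ∈ (Finset.range m).erase p, if g q = j then 1 else 0 :=
    Finset.sum_congr rfl fun q hq => by
      rw [Function.update_of_ne (Finset.ne_of_mem_erase hq)]
  rw [this, Function.update_self]
  simp only [eq_comm (a := j)]
  omega

/-! ### The breadth-first search tree -/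

/-- The search tree of the visited agents `Q 0 = 0, Q 1, …, Q (T - 1)`: the agent `Q x`, `x ≥ 1`,
was reached through the item `par (Q x)` of an agent visited earlier. -/
structure SearchTree (n : ℕ) (E : ℕ → ℕ → Prop) (g : ℕ → ℕ) (K T : ℕ)
    (Q par vis : ℕ → ℕ) : Prop where
  pos : 1 ≤ T
  root : Q 0 = 0
  range : ∀ x, 1 ≤ x → x < T → 1 ≤ Q x ∧ Q x ≤ n
  mark : ∀ x, 1 ≤ x → x < T → vis (Q x) = K
  edge : ∀ x, 1 ≤ x → x < T → E (par (Q x)) (Q x)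
  item : ∀ x, 1 ≤ x → x < T → par (Q x) < K
  owner : ∀ x, 1 ≤ x → x < T → ∃ y, y < x ∧ Q y = g (par (Q x))
  inj : ∀ x y, x < T → y < T → Q x = Q y → x = y
  visited : ∀ j, vis j = K → ∃ x, 1 ≤ x ∧ x < T ∧ Q x = j
  vis_le : ∀ j, vis j ≤ K

namespace SearchTree

variable {n : ℕ} {E : ℕ → ℕ → Prop} {g : ℕ → ℕ} {K T : ℕ} {Q par vis : ℕ → ℕ}

/-- Marks are time stamps: earlier searches left marks at most `k`, so `k + 1` is fresh and the
array of marks need not be cleared. -/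
theorem init {k : ℕ} (hroot : Q 0 = 0) (hvis : ∀ j, vis j ≤ k) :
    SearchTree n E g (k + 1) 1 Q par vis where
  pos := le_rfl
  root := hroot
  range x h h' := by omega
  mark x h h' := by omega
  edge x h h' := by omega
  item x h h' := by omega
  owner x h h' := by omega
  inj x y h h' _ := by omega
  visited j h := by have := hvis j; omega
  vis_le j := (hvis j).trans (Nat.le_succ k)

theorem le_agents (h : SearchTree n E g K T Q par vis) {x : ℕ} (hx : x < T) : Q x ≤ n := by
  rcases Nat.eq_zero_or_pos x with rfl | hx0
  · rw [h.root]; exact Nat.zero_le _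
  · exact (h.range x hx0 hx).2

theorem tail_le (h : SearchTree n E g K T Q par vis) : T ≤ n + 1 := by
  rw [← Finset.card_range T, ← Finset.card_range (n + 1)]
  refine Finset.card_le_card_of_injOn Q (fun x hx => ?_) fun x hx y hy hxy => ?_
  · have := h.le_agents (by simpa using hx)
    simp only [Finset.coe_range, Set.mem_Iio]
    omega
  · exact h.inj x y (by simpa using hx) (by simpa using hy) hxy

/-- A mark below `K` certifies that `j` is not yet in the queue, which keeps the queue injective. -/
theorem push (h : SearchTree n E g K T Q par vis) {j q : ℕ} (hj : 1 ≤ j) (hjn : j ≤ n)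
    (hvis : vis j < K) (hE : E q j) (hq : q < K) (hown : ∃ y, y < T ∧ Q y = g q) :
    SearchTree n E g K (T + 1) (Function.update Q T j) (Function.update par j q)
      (Function.update vis j K) := by
  have hne : ∀ x, 1 ≤ x → x < T → Q x ≠ j := fun x h1 h2 e => by
    have := h.mark x h1 h2
    rw [e] at this
    omega
  have hne0 : ∀ x, x < T → Q x ≠ j := fun x h2 e => by
    rcases Nat.eq_zero_or_pos x with rfl | hx0
    · rw [h.root] at e; omega
    · exact hne x hx0 h2 e
  have hT := h.pos
  have hQ : ∀ x, x < T → Function.update Q T j x = Q x := fun x hx =>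
    Function.update_of_ne (by omega) _ _
  have hQT : Function.update Q T j T = j := Function.update_self _ _ _
  have cases : ∀ (P : ℕ → Prop), (∀ x, 1 ≤ x → x < T → P x) → P T →
      ∀ x, 1 ≤ x → x < T + 1 → P x := by
    intro P h1 h2 x hx hxT
    rcases Nat.lt_succ_iff_lt_or_eq.1 hxT with h3 | rfl
    · exact h1 x hx h3
    · exact h2
  refine ⟨by omega, by rw [hQ 0 (by omega), h.root], ?_, ?_, ?_, ?_, ?_, ?_, ?_, ?_⟩
  · refine cases _ (fun x h1 h2 => ?_) (by rw [hQT]; exact ⟨hj, hjn⟩)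
    rw [hQ x h2]; exact h.range x h1 h2
  · refine cases _ (fun x h1 h2 => ?_) (by rw [hQT, Function.update_self])
    rw [hQ x h2, Function.update_of_ne (hne x h1 h2)]; exact h.mark x h1 h2
  · refine cases _ (fun x h1 h2 => ?_) (by rw [hQT, Function.update_self]; exact hE)
    rw [hQ x h2, Function.update_of_ne (hne x h1 h2)]; exact h.edge x h1 h2
  · refine cases _ (fun x h1 h2 => ?_) (by rw [hQT, Function.update_self]; exact hq)
    rw [hQ x h2, Function.update_of_ne (hne x h1 h2)]; exact h.item x h1 h2
  · refine cases _ (fun x h1 h2 => ?_) ?_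
    · obtain ⟨y, hy, e⟩ := h.owner x h1 h2
      rw [hQ x h2, Function.update_of_ne (hne x h1 h2)]
      exact ⟨y, hy, by rw [hQ y (by omega), e]⟩
    · obtain ⟨y, hy, e⟩ := hown
      rw [hQT, Function.update_self]
      exact ⟨y, hy, by rw [hQ y hy, e]⟩
  · intro x y hx hy e
    rcases Nat.lt_succ_iff_lt_or_eq.1 hx with h1 | rfl <;>
      rcases Nat.lt_succ_iff_lt_or_eq.1 hy with h2 | rfl
    · rw [hQ x h1, hQ y h2] at e; exact h.inj x y h1 h2 e
    · rw [hQ x h1, hQT] at e; exact absurd e (hne0 x h1)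
    · rw [hQ y h2, hQT] at e; exact absurd e.symm (hne0 y h2)
    · rfl
  · intro a ha
    by_cases haj : a = j
    · exact ⟨T, hT, Nat.lt_succ_self T, by rw [hQT, haj]⟩
    · rw [Function.update_of_ne haj] at ha
      obtain ⟨x, h1, h2, h3⟩ := h.visited a ha
      exact ⟨x, h1, by omega, by rw [hQ x h2, h3]⟩
  · intro a
    by_cases haj : a = j
    · rw [haj, Function.update_self]
    · rw [Function.update_of_ne haj]; exact h.vis_le a

end SearchTree

/-! ### Moving items along a tree path -/

/-- Membership in `R` is inherited from `a` to `w` for every closed `R`. -/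
def Leads (E : ℕ → ℕ → Prop) (g : ℕ → ℕ) (a w : ℕ) : Prop :=
  ∀ R, ClosedUnder E g R → a ∈ R → w ∈ R

/-- The assignment `g'` arises from `g` by moving the items along the tree path that ends in `w`,
from `w` back to the agent `Q x`. -/
structure PathShift (m : ℕ) (E : ℕ → ℕ → Prop) (g : ℕ → ℕ) (k T : ℕ) (Q : ℕ → ℕ) (w x : ℕ)
    (g' : ℕ → ℕ) : Prop where
  lt : x < T
  leads : Leads E g (Q x) w
  changed : ∀ q, g' q ≠ g q → E q (g' q) ∧ q < k + 1 ∧ g' q ≠ 0 ∧ Leads E g (g' q) w ∧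
    ∃ y, x ≤ y ∧ y < T ∧ Q y = g q
  load : ∀ j, loadOf m g' j + (if j = Q x then 1 else 0) =
    loadOf m g j + if j = w then 1 else 0
  last : Q x = 0 → w ≠ 0 → g' k ≠ 0

namespace PathShift

variable {m n : ℕ} {E : ℕ → ℕ → Prop} {g g' : ℕ → ℕ} {k T : ℕ} {Q par vis : ℕ → ℕ} {w x : ℕ}

theorem init (hx : x < T) : PathShift m E g k T Q (Q x) x g where
  lt := hx
  leads _ _ h := h
  changed _ h := absurd rfl h
  load _ := rfl
  last h h' := absurd h h'

/-- During the shift `Q x` is one item short and `w` has one extra. Taking the item `par (Q x)`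
passes the shortage on to its owner, who stands earlier in the queue. -/
theorem step (hg : PartialStable m E k g) (ht : SearchTree n E g (k + 1) T Q par vis)
    (hE : ∀ q j, E q j → q < m) (h : PathShift m E g k T Q w x g') (hx : Q x ≠ 0) :
    ∃ y, y < x ∧ g' (par (Q x)) = Q y ∧
      PathShift m E g k T Q w y (Function.update g' (par (Q x)) (Q x)) := by
  have hx1 : 1 ≤ x := by
    rcases Nat.eq_zero_or_pos x with rfl | h0
    · exact absurd ht.root hx
    · exact h0
  have hxT := h.lt
  have he := ht.edge x hx1 hxT
  obtain ⟨y, hy, hyo⟩ := ht.owner x hx1 hxT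
  -- Items moved so far had owners at positions from `x` on, whereas this one's owner sits at `y <
  -- x`.
  have hsame : g' (par (Q x)) = g (par (Q x)) := by
    by_contra hne
    obtain ⟨-, -, -, -, z, hz1, hz2, hz3⟩ := h.changed _ hne
    have := ht.inj z y hz2 (by omega) (hz3.trans hyo.symm)
    omega
  refine ⟨y, hy, hsame.trans hyo.symm, ⟨by omega, ?_, ?_, ?_, ?_⟩⟩
  · intro R hR hyR
    rw [hyo] at hyR
    exact h.leads R hR (hR _ hyR _ he)
  · intro q hq
    by_cases hqp : q = par (Q x)
    · subst hqp
      rw [Function.update_self]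
      exact ⟨he, ht.item x hx1 hxT, hx, h.leads, y, le_rfl, by omega, hyo⟩
    · rw [Function.update_of_ne hqp] at hq ⊢
      obtain ⟨h1, h2, h3, h4, z, hz1, hz2⟩ := h.changed q hq
      exact ⟨h1, h2, h3, h4, z, by omega, hz2⟩
  · intro j
    have h1 := h.load j
    have h2 := loadOf_update (hE _ _ he) g' (Q x) j
    rw [hsame, ← hyo] at h2
    omega
  · intro hy0 _
    rw [hyo] at hy0
    -- Unassigned items below `k` are valued by nobody, so a path can leave agent 0 only through
    -- item `k`.
    have hk : par (Q x) = k := by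
      have := ht.item x hx1 hxT
      by_contra hne
      exact hg.full _ (by omega) hy0 _ he
    rw [hk, Function.update_self]
    exact hx

/-- The visited set is closed and `w` has the least load in it. If agent 0 is the only entry of the
queue, nobody values the new item and nothing moves. -/
theorem partialStable (hg : PartialStable m E k g)
    (ht : SearchTree n E g (k + 1) T Q par vis)
    (hclosed : ∀ y, y < T → ∀ q, q < k + 1 → g q = Q y → ∀ j, E q j → vis j = k + 1)
    (hw : 2 ≤ T → w ≠ 0) (hwT : ∃ y, y < T ∧ Q y = w)
    (hmin : ∀ y, 1 ≤ y → y < T → loadOf m g w ≤ loadOf m g (Q y))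
    (h : PathShift m E g k T Q w x g') (hx : Q x = 0) : PartialStable m E (k + 1) g' where
  clean q hq := by
    by_cases hne : g' q = g q
    · rw [hne] at hq ⊢; exact hg.clean q hq
    · exact (h.changed q hne).1
  lt q hq := by
    by_cases hne : g' q = g q
    · rw [hne] at hq; have := hg.lt q hq; omega
    · exact (h.changed q hne).2.1
  full q hqk hq j hE := by
    have hne : g' q = g q := by
      by_contra hne
      exact (h.changed q hne).2.2.1 hq
    rcases Nat.lt_succ_iff_lt_or_eq.1 hqk with h1 | rfl
    · exact hg.full q h1 (hne.symm.trans hq) j hE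
    -- Item `k` belongs to the root here, so an agent valuing it was visited. Then `w` is a true
    -- agent and the finished shift has assigned `k`, a contradiction.
    · have hv := hclosed 0 ht.pos q hqk ((hne.symm.trans hq).trans ht.root.symm) j hE
      obtain ⟨y, h1, h2, -⟩ := ht.visited j hv
      exact h.last hx (hw (by omega)) hq
  cut t := by
    have hload : ∀ j, j ≠ 0 → loadOf m g' j = loadOf m g j + if j = w then 1 else 0 := by
      intro j hj
      rw [← h.load j, hx, if_neg hj, add_zero]
    obtain ⟨R, h1, h2, h3⟩ := hg.cut t
    -- In the first case all visited agents have load at least `t` and may join the cut. Otherwise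
    -- `w` lies outside the old cut, and its new load does not force it in.
    by_cases hT : 2 ≤ T ∧ t ≤ loadOf m g w
    · refine ⟨R ∪ {j | ∃ y, 1 ≤ y ∧ y < T ∧ Q y = j}, fun j hj hjt => ?_, fun j hj => ?_,
        fun q hq j hE => ?_⟩
      · rw [hload j hj] at hjt
        split_ifs at hjt with hjw
        · obtain ⟨y, hy, e⟩ := hwT
          refine Or.inr ⟨y, ?_, hy, e.trans hjw.symm⟩
          rcases Nat.eq_zero_or_pos y with rfl | h0
          · exact absurd (hjw.trans (e.symm.trans ht.root)) hj
          · exact h0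
        · exact Or.inl (h1 j hj hjt)
      · rcases hj with hj | ⟨y, hy1, hy2, rfl⟩
        · have := h2 j hj
          rw [hload j this.1]
          exact ⟨this.1, by omega⟩
        · have h0 : Q y ≠ 0 := by have := ht.range y hy1 hy2; omega
          rw [hload _ h0]
          have := hmin y hy1 hy2
          exact ⟨h0, by omega⟩
      · by_cases hne : g' q = g q
        · rw [hne] at hq
          rcases hq with hq | ⟨y, hy1, hy2, e⟩
          · exact Or.inl (h3 q hq j hE)
          · have h0 : g q ≠ 0 := by have := ht.range y hy1 hy2; omega
            have := hg.lt q h0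
            exact Or.inr (ht.visited j (hclosed y hy2 q (by omega) e.symm j hE))
        -- A moved item had a visited old owner, so all who value it were visited.
        · obtain ⟨-, hqk, -, -, y, -, hy, e⟩ := h.changed q hne
          exact Or.inr (ht.visited j (hclosed y hy q hqk e.symm j hE))
    · have hwR : w ∉ R := fun hwR => by
        obtain ⟨hw0, hwt⟩ := h2 w hwR
        obtain ⟨y, hy, e⟩ := hwT
        have : 1 ≤ y := by
          rcases Nat.eq_zero_or_pos y with rfl | h0
          · exact absurd (e.symm.trans ht.root) hw0
          · exact h0
        exact hT ⟨by omega, hwt⟩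
      refine ⟨R, fun j hj hjt => ?_, fun j hj => ?_, fun q hq j hE => ?_⟩
      · rw [hload j hj] at hjt
        split_ifs at hjt with hjw
        · subst hjw
          obtain ⟨y, hy, e⟩ := hwT
          have : 1 ≤ y := by
            rcases Nat.eq_zero_or_pos y with rfl | h0
            · exact absurd (e.symm.trans ht.root) hj
            · exact h0
          have := h1 j hj
          by_contra
          exact hT ⟨by omega, by omega⟩
        · exact h1 j hj hjt
      · have := h2 j hj
        rw [hload j this.1]
        exact ⟨this.1, by omega⟩
      · by_cases hne : g' q = g q
        · rw [hne] at hq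
          exact h3 q hq j hE
        -- A new owner inside `R` would lead to `w` within `R`, by closure under the old assignment.
        · exact absurd ((h.changed q hne).2.2.2.1 R h3 hq) hwR

end PathShift

/-! ### Rules for running programs -/

/-- `p`, started in `s`, halts, and its running time and final state satisfy `Q`. -/
def Run (W : ℕ) (p : Prog) (s : State) (Q : ℕ → State → Prop) : Prop :=
  ∃ t s', Exec W p s t s' ∧ Q t s'

theorem State.reg_setReg (s : State) (x a y : ℕ) :
    (s.setReg x a).reg y = if y = x then a else s.reg y := Function.update_apply _ _ _ _

theorem State.arr_setReg (s : State) (x a : ℕ) : (s.setReg x a).arr = s.arr := rfl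

theorem State.reg_setArr (s : State) (a k x : ℕ) : (s.setArr a k x).reg = s.reg := rfl

theorem State.arr_setArr (s : State) (a k x b : ℕ) :
    (s.setArr a k x).arr b = if b = a then Function.update (s.arr a) k x else s.arr b :=
  Function.update_apply _ _ _ _

namespace Run

variable {W : ℕ} {s : State} {Q R : ℕ → State → Prop} {p q : Prog} {x y z a k : ℕ}

theorem mono (h : Run W p s Q) (hQ : ∀ t s', Q t s' → R t s') : Run W p s R := by
  obtain ⟨t, s', he, hq⟩ := h
  exact ⟨t, s', he, hQ t s' hq⟩

theorem skip (h : Q 1 s) : Run W .skip s Q := ⟨1, s, .skip s, h⟩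

theorem const (hk : k < W) (h : Q 1 (s.setReg x k)) : Run W (.const x k) s Q :=
  ⟨1, _, .const x k s hk, h⟩

theorem copy (h : Q 1 (s.setReg x (s.reg y))) : Run W (.copy x y) s Q :=
  ⟨1, _, .copy x y s, h⟩

theorem add (hW : s.reg y + s.reg z < W) (h : Q 1 (s.setReg x (s.reg y + s.reg z))) :
    Run W (.add x y z) s Q := ⟨1, _, .add x y z s hW, h⟩

theorem mul (hW : s.reg y * s.reg z < W) (h : Q 1 (s.setReg x (s.reg y * s.reg z))) :
    Run W (.mul x y z) s Q := ⟨1, _, .mul x y z s hW, h⟩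

theorem load (h : Q 1 (s.setReg x (s.arr a (s.reg y)))) : Run W (.load x a y) s Q :=
  ⟨1, _, .load x a y s, h⟩

theorem store (h : Q 1 (s.setArr a (s.reg x) (s.reg y))) : Run W (.store a x y) s Q :=
  ⟨1, _, .store a x y s, h⟩

theorem seq (h : Run W p s fun t s' => Run W q s' fun t' s'' => Q (t + t') s'') :
    Run W (.seq p q) s Q := by
  obtain ⟨t, s', he, t', s'', he', hq⟩ := h
  exact ⟨_, _, .seq he he', hq⟩

theorem ifLt (h : s.reg x < s.reg y → Run W p s fun t s' => Q (t + 1) s')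
    (h' : ¬ s.reg x < s.reg y → Run W q s fun t s' => Q (t + 1) s') :
    Run W (.ifLt x y p q) s Q := by
  by_cases hlt : s.reg x < s.reg y
  · obtain ⟨t, s', he, hq⟩ := h hlt
    exact ⟨_, _, .ifTrue hlt he, hq⟩
  · obtain ⟨t, s', he, hq⟩ := h' hlt
    exact ⟨_, _, .ifFalse hlt he, hq⟩

/-- The rule for loops. The first argument of the invariant bounds the remaining time. -/
theorem whileLt (I : ℕ → State → Prop) (hpos : ∀ κ s, I κ s → 1 ≤ κ)
    (hbody : ∀ κ s, I κ s → s.reg x < s.reg y →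
      Run W p s fun t s' => ∃ κ', I κ' s' ∧ t + 1 + κ' ≤ κ) :
    ∀ (κ : ℕ) (s : State), I κ s →
      Run W (.whileLt x y p) s fun t s' => t ≤ κ ∧ (∃ κ', I κ' s') ∧ ¬ s'.reg x < s'.reg y := by
  intro κ
  induction κ using Nat.strong_induction_on with
  | _ κ ih =>
    intro s hI
    by_cases hlt : s.reg x < s.reg y
    · obtain ⟨t, s', he, κ', hI', hle⟩ := hbody κ s hI hlt
      obtain ⟨t', s'', he', hle', h1, h2⟩ := ih κ' (by omega) s' hI'
      exact ⟨_, _, .whileTrue hlt he he', by omega, h1, h2⟩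
    · exact ⟨1, s, .whileFalse hlt, hpos κ s hI, ⟨κ, hI⟩, hlt⟩

end Run

/-! ### The program -/

/-- Agent `j` (numbered from 1) values item `q`, according to the matrix `M`. -/
def Wants (m n : ℕ) (M : ℕ → ℕ) (q j : ℕ) : Prop :=
  q < m ∧ 1 ≤ j ∧ j ≤ n ∧ 0 < M (q * n + (j - 1))

/-- Registers: 0 `m`, 1 `n`, 2 zero, 3 one, 4 the current item `k`, 5 `k + 1`, 6 and 7 head and
tail of the queue, 8 to 16 local variables. Arrays: 0 input, 1 assignment, 2 loads, 3 queue,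
4 tree items, 5 visiting marks. This part visits the agents that value item `q`. -/
def scanAgents : Prog :=
  .whileLt 11 1 <| .seq (.add 12 10 11) <| .seq (.load 12 0 12) <| .seq (.add 11 11 3) <|
    .ifLt 2 12
      (.seq (.load 12 5 11) <|
        .ifLt 12 5
          (.seq (.store 5 11 5) <| .seq (.store 4 11 9) <| .seq (.store 3 7 11) <| .add 7 7 3)
          .skip)
      .skip

/-- Scan the items of agent `i`, in register 8. -/
def scanItems : Prog :=
  .whileLt 9 5 <| .seq (.load 12 1 9) <|
    .seq (.ifLt 12 8 .skip <| .ifLt 8 12 .skip <|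
      .seq (.mul 10 9 1) <| .seq (.copy 11 2) scanAgents) <|
    .add 9 9 3

/-- Breadth-first search. -/
def search : Prog :=
  .whileLt 6 7 <| .seq (.load 8 3 6) <| .seq (.add 6 6 3) <| .seq (.copy 9 2) scanItems

/-- Find a visited agent of least load. -/
def pickLeast : Prog :=
  .whileLt 16 7 <| .seq (.load 12 3 16) <| .seq (.load 13 2 12) <|
    .seq (.ifLt 13 15 (.seq (.copy 14 12) (.copy 15 13)) .skip) <| .add 16 16 3

/-- Move the items along the tree path that ends in the agent of register 14. -/
def shiftPath : Prog :=
  .whileLt 2 14 <| .seq (.load 12 4 14) <| .seq (.load 13 1 12) <| .seq (.store 1 12 14) <|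
    .copy 14 13

def insertItem : Prog :=
  .seq (.add 5 4 3) <| .seq (.store 3 2 2) <| .seq (.copy 6 2) <| .seq (.copy 7 3) <|
  .seq search <|
  .seq (.copy 14 2) <| .seq (.copy 15 0) <| .seq (.copy 16 3) <| .seq pickLeast <|
  .seq (.add 15 15 3) <| .seq (.store 2 14 15) <| .seq shiftPath <| .copy 4 5

def stableProg : Prog := .seq (.const 3 1) <| .whileLt 4 0 insertItem

/-! ### Search -/

/-- The part of the state that stays fixed during a search: writes go to registers from 6 on and
arrays from 1 on. -/
structure Base (m n : ℕ) (M : ℕ → ℕ) (k : ℕ) (s : State) : Prop where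
  r0 : s.reg 0 = m
  r1 : s.reg 1 = n
  r2 : s.reg 2 = 0
  r3 : s.reg 3 = 1
  r4 : s.reg 4 = k
  r5 : s.reg 5 = k + 1
  a0 : s.arr 0 = M

theorem Base.setReg {m n k : ℕ} {M : ℕ → ℕ} {s : State} (h : Base m n M k s) {x : ℕ} (hx : 6 ≤ x)
    (a : ℕ) : Base m n M k (s.setReg x a) := by
  obtain ⟨h0, h1, h2, h3, h4, h5, ha⟩ := h
  refine ⟨?_, ?_, ?_, ?_, ?_, ?_, ha⟩ <;> rw [State.reg_setReg, if_neg (by omega)] <;> assumption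

theorem Base.setArr {m n k : ℕ} {M : ℕ → ℕ} {s : State} (h : Base m n M k s) {a : ℕ} (ha : 1 ≤ a)
    (x y : ℕ) : Base m n M k (s.setArr a x y) := by
  obtain ⟨h0, h1, h2, h3, h4, h5, ha0⟩ := h
  refine ⟨h0, h1, h2, h3, h4, h5, ?_⟩
  rw [State.arr_setArr, if_neg (by omega), ha0]

/-- The invariant of the search: the first `h` entries of the queue are those of `A`, and the
agents `j` that value an item `q` with `P q j` have been visited. -/
structure SearchInv (m n : ℕ) (M : ℕ → ℕ) (k : ℕ) (g L : ℕ → ℕ) (h : ℕ) (A : ℕ → ℕ)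
    (P : ℕ → ℕ → Prop) (s : State) : Prop where
  base : Base m n M k s
  a1 : s.arr 1 = g
  a2 : s.arr 2 = L
  r6 : s.reg 6 = h
  head_le : h ≤ s.reg 7
  pref : ∀ x, x < h → s.arr 3 x = A x
  tree : SearchTree n (Wants m n M) g (k + 1) (s.reg 7) (s.arr 3) (s.arr 4) (s.arr 5)
  cov : ∀ q j, P q j → q < k + 1 → Wants m n M q j → s.arr 5 j = k + 1

namespace SearchInv

variable {m n k h : ℕ} {M g L A : ℕ → ℕ} {P P' : ℕ → ℕ → Prop} {s : State}

theorem setReg (hs : SearchInv m n M k g L h A P s) {x : ℕ} (hx : 8 ≤ x) (a : ℕ) :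
    SearchInv m n M k g L h A P (s.setReg x a) := by
  obtain ⟨hb, h1, h2, h6, hh, hp, ht, hc⟩ := hs
  have e7 : (s.setReg x a).reg 7 = s.reg 7 := by rw [State.reg_setReg, if_neg (by omega)]
  have e6 : (s.setReg x a).reg 6 = s.reg 6 := by rw [State.reg_setReg, if_neg (by omega)]
  refine ⟨hb.setReg (by omega) a, h1, h2, e6.trans h6, ?_, hp, ?_, hc⟩
  · rw [e7]; exact hh
  · rw [e7]; exact ht

theorem imp (hs : SearchInv m n M k g L h A P s)
    (hP : ∀ q j, q < k + 1 → Wants m n M q j → P' q j → P q j ∨ s.arr 5 j = k + 1) :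
    SearchInv m n M k g L h A P' s := by
  obtain ⟨hb, h1, h2, h6, hh, hp, ht, hc⟩ := hs
  exact ⟨hb, h1, h2, h6, hh, hp, ht, fun q j hq hqk hE =>
    (hP q j hqk hE hq).elim (fun h => hc q j h hqk hE) id⟩

end SearchInv

/-- The pairs treated when the first `h` agents of `A`, the items below `q` of agent `i`, and for
item `q` the agents up to `j` have been treated. -/
def Treated (g : ℕ → ℕ) (h : ℕ) (A : ℕ → ℕ) (i q j : ℕ) (q' j' : ℕ) : Prop :=
  (∃ x, x < h ∧ A x = g q') ∨ (g q' = i ∧ (q' < q ∨ (q' = q ∧ j' ≤ j)))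

section

variable {W m n k h : ℕ} {M g L A : ℕ → ℕ}

/-- A full round costs 11: three tests and eight instructions. The counter runs from 0, so after its
increment it names the agent whose matrix column was just read. -/
theorem run_scanAgents (hW : m * n + m + n + 2 ≤ W) (hkm : k < m) {i q : ℕ} (hq : q < k + 1)
    (hgq : g q = i) (hi : ∃ y, y < h + 1 ∧ A y = i) (s : State)
    (hs : SearchInv m n M k g L (h + 1) A (Treated g h A i q 0) s)
    (h8 : s.reg 8 = i) (h9 : s.reg 9 = q) (h10 : s.reg 10 = q * n) (h11 : s.reg 11 = 0) :
    Run W scanAgents s fun t s' => t ≤ 11 * n + 1 ∧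
      SearchInv m n M k g L (h + 1) A (Treated g h A i (q + 1) 0) s' ∧
      s'.reg 8 = i ∧ s'.reg 9 = q := by
  have hqn : q * n + n ≤ m * n := by
    rw [← Nat.succ_mul]; exact Nat.mul_le_mul_right n (by omega)
  refine (Run.whileLt (fun κ s => ∃ j, κ = 11 * (n - j) + 1 ∧ j ≤ n ∧ s.reg 11 = j ∧
    s.reg 8 = i ∧ s.reg 9 = q ∧ s.reg 10 = q * n ∧
    SearchInv m n M k g L (h + 1) A (Treated g h A i q j) s) ?_ ?_ (11 * n + 1) s
    ⟨0, by omega, by omega, h11, h8, h9, h10, hs⟩).mono ?_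
  · rintro κ s ⟨j, rfl, -⟩
    omega
  · rintro κ s ⟨j, rfl, hjn, h11, h8, h9, h10, hs⟩ hlt
    rw [h11, hs.base.r1] at hlt
    refine Run.seq (Run.add (by omega) (Run.seq (Run.load (Run.seq (Run.add ?_ ?_)))))
    · simp only [State.reg_setReg, h11, hs.base.r3]
      norm_num
      omega
    have hM : (s.setReg 12 (s.reg 10 + s.reg 11)).arr 0 ((s.setReg 12
        (s.reg 10 + s.reg 11)).reg 12) = M (q * n + j) := by
      simp only [State.reg_setReg, State.arr_setReg, if_true, h10, h11, hs.base.a0]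
    rw [hM]
    have hs₁ := ((hs.setReg (x := 12) (by omega) (s.reg 10 + s.reg 11)).setReg (x := 12) (by omega)
      (M (q * n + j))).setReg (x := 11) (by omega) (j + 1)
    have e11 : ((s.setReg 12 (s.reg 10 + s.reg 11)).setReg 12 (M (q * n + j))).reg 11 +
        ((s.setReg 12 (s.reg 10 + s.reg 11)).setReg 12 (M (q * n + j))).reg 3 = j + 1 := by
      simp [State.reg_setReg, h11, hs.base.r3]
    rw [e11]
    generalize hs₁e : ((s.setReg 12 (s.reg 10 + s.reg 11)).setReg 12 (M (q * n + j))).setReg 11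
      (j + 1) = s₁ at hs₁ ⊢
    have f8 : s₁.reg 8 = i := by rw [← hs₁e]; simp [State.reg_setReg, h8]
    have f9 : s₁.reg 9 = q := by rw [← hs₁e]; simp [State.reg_setReg, h9]
    have f10 : s₁.reg 10 = q * n := by rw [← hs₁e]; simp [State.reg_setReg, h10]
    have f11 : s₁.reg 11 = j + 1 := by rw [← hs₁e]; simp [State.reg_setReg]
    have f12 : s₁.reg 12 = M (q * n + j) := by rw [← hs₁e]; simp [State.reg_setReg]
    clear hs₁e e11 hM hs h11 h8 h9 h10 s
    have next : ∀ s', SearchInv m n M k g L (h + 1) A (Treated g h A i q j) s' →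
        (Wants m n M q (j + 1) → s'.arr 5 (j + 1) = k + 1) →
        SearchInv m n M k g L (h + 1) A (Treated g h A i q (j + 1)) s' := by
      intro s' hs' hv
      refine hs'.imp fun q' j' _ hE hT => ?_
      rcases hT with hT | ⟨e, hT | ⟨rfl, hT⟩⟩
      · exact Or.inl (Or.inl hT)
      · exact Or.inl (Or.inr ⟨e, Or.inl hT⟩)
      · rcases Nat.lt_or_ge j j' with hj | hj
        · obtain rfl : j' = j + 1 := by omega
          exact Or.inr (hv hE)
        · exact Or.inl (Or.inr ⟨e, Or.inr ⟨rfl, hj⟩⟩)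
    refine Run.ifLt (fun hpos => ?_) (fun hpos => ?_)
    · rw [hs₁.base.r2, f12] at hpos
      have hE : Wants m n M q (j + 1) := ⟨by omega, by omega, by omega, by simpa using hpos⟩
      refine Run.seq (Run.load ?_)
      rw [f11]
      have hs₂ := hs₁.setReg (x := 12) (by omega) (s₁.arr 5 (j + 1))
      generalize hs₂e : s₁.setReg 12 (s₁.arr 5 (j + 1)) = s₂ at hs₂ ⊢
      have g8 : s₂.reg 8 = i := by rw [← hs₂e]; simp [State.reg_setReg, f8]
      have g9 : s₂.reg 9 = q := by rw [← hs₂e]; simp [State.reg_setReg, f9]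
      have g10 : s₂.reg 10 = q * n := by rw [← hs₂e]; simp [State.reg_setReg, f10]
      have g11 : s₂.reg 11 = j + 1 := by rw [← hs₂e]; simp [State.reg_setReg, f11]
      have g12 : s₂.reg 12 = s₂.arr 5 (j + 1) := by
        rw [← hs₂e]; simp [State.reg_setReg, State.arr_setReg]
      clear hs₂e f8 f9 f10 f11 f12 hs₁ s₁
      refine Run.ifLt (fun hv => ?_) (fun hv => ?_)
      · rw [g12, hs₂.base.r5] at hv
        have hpush := hs₂.tree.push (j := j + 1) (q := q) (by omega) (by omega) hv hE hq (by
          obtain ⟨y, hy, e⟩ := hi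
          exact ⟨y, lt_of_lt_of_le hy hs₂.head_le, by rw [hs₂.pref y hy, e, hgq]⟩)
        have htail := hpush.tail_le
        have hh := hs₂.head_le
        refine Run.seq (Run.store (Run.seq (Run.store (Run.seq (Run.store (Run.add ?_ ?_))))))
        · simp only [State.reg_setArr, hs₂.base.r3]
          omega
        simp only [State.reg_setArr, hs₂.base.r3, g11, g9, hs₂.base.r5]
        refine ⟨_, ⟨j + 1, rfl, by omega, ?_, ?_, ?_, ?_, next _ ?_ ?_⟩, by omega⟩
        · simpa [State.reg_setReg, State.reg_setArr] using g11
        · simpa [State.reg_setReg, State.reg_setArr] using g8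
        · simpa [State.reg_setReg, State.reg_setArr] using g9
        · simpa [State.reg_setReg, State.reg_setArr] using g10
        · constructor
          · exact (((hs₂.base.setArr (by omega) _ _).setArr (by omega) _ _).setArr
              (by omega) _ _).setReg (by omega) _
          · simpa [State.arr_setReg, State.arr_setArr] using hs₂.a1
          · simpa [State.arr_setReg, State.arr_setArr] using hs₂.a2
          · simpa [State.reg_setReg, State.reg_setArr] using hs₂.r6
          · simp only [State.reg_setReg, if_true]
            omega
          -- The push writes at the tail, beyond the processed prefix.
          · intro x hx
            have hne : x ≠ s₂.reg 7 := by omega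
            simpa [State.arr_setReg, State.arr_setArr, Function.update_of_ne hne] using
              hs₂.pref x hx
          · simpa [State.arr_setReg, State.arr_setArr, State.reg_setReg] using hpush
          · intro q' j' hT hq' hE'
            have := hs₂.cov q' j' hT hq' hE'
            by_cases hj : j' = j + 1
            · simp [State.arr_setReg, State.arr_setArr, hj]
            · simpa [State.arr_setReg, State.arr_setArr, Function.update_of_ne hj] using this
        · intro _
          simp [State.arr_setReg, State.arr_setArr]
      · rw [g12, hs₂.base.r5] at hv
        have := hs₂.tree.vis_le (j + 1)
        exact Run.skip ⟨_, ⟨j + 1, rfl, by omega, g11, g8, g9, g10,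
          next _ hs₂ fun _ => by omega⟩, by omega⟩
    · rw [hs₁.base.r2, f12] at hpos
      exact Run.skip ⟨_, ⟨j + 1, rfl, by omega, f11, f8, f9, f10,
        next _ hs₁ fun hE => absurd hE.2.2.2 (by simpa using hpos)⟩, by omega⟩
  · rintro t s' ⟨ht, ⟨κ, j, -, hjn, h11, h8, h9, -, hs'⟩, hlt⟩
    rw [h11, hs'.base.r1] at hlt
    refine ⟨ht, hs'.imp fun q' j' _ hE hT => Or.inl ?_, h8, h9⟩
    rcases hT with hT | ⟨e, hT | ⟨rfl, hT⟩⟩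
    · exact Or.inl hT
    · rcases Nat.lt_succ_iff_lt_or_eq.1 hT with h1 | h1
      · exact Or.inr ⟨e, Or.inl h1⟩
      · exact Or.inr ⟨e, Or.inr ⟨h1, by have := hE.2.2.1; omega⟩⟩
    · have := hE.2.1; omega

theorem run_scanItems (hW : m * n + m + n + 2 ≤ W) (hkm : k < m) {i : ℕ}
    (hi : ∃ y, y < h + 1 ∧ A y = i) (s : State)
    (hs : SearchInv m n M k g L (h + 1) A (Treated g h A i 0 0) s)
    (h8 : s.reg 8 = i) (h9 : s.reg 9 = 0) :
    Run W scanItems s fun t s' =>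
      t ≤ 8 * (k + 1) + 11 * n * ((Finset.range (k + 1)).filter fun q => g q = i).card + 1 ∧
      SearchInv m n M k g L (h + 1) A (Treated g h A i (k + 1) 0) s' := by
  -- The items of agent `i` still ahead. Only these pay `11 * n` for a scan of the agents; the
  -- remaining work is at most 8 per item.
  set N : ℕ → ℕ := fun q => ((Finset.range (k + 1)).filter fun q' => q ≤ q' ∧ g q' = i).card
    with hN
  have hN0 : N 0 = ((Finset.range (k + 1)).filter fun q => g q = i).card := by simp [hN]
  have hNstep : ∀ q, q < k + 1 → N q = N (q + 1) + if g q = i then 1 else 0 := by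
    intro q hq
    have hmem := Finset.mem_range.2 hq
    simp only [hN, Finset.card_filter]
    rw [← Finset.add_sum_erase _ _ hmem, ← Finset.add_sum_erase _
      (fun q' => if q + 1 ≤ q' ∧ g q' = i then 1 else 0) hmem]
    have : ∑ q' ∈ (Finset.range (k + 1)).erase q, (if q ≤ q' ∧ g q' = i then 1 else 0) =
        ∑ q' ∈ (Finset.range (k + 1)).erase q, if q + 1 ≤ q' ∧ g q' = i then 1 else 0 := by
      refine Finset.sum_congr rfl fun q' hq' => ?_
      have := Finset.ne_of_mem_erase hq'
      have : q ≤ q' ↔ q + 1 ≤ q' := by omega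
      simp only [this]
    rw [this]
    simp
    omega
  rw [← hN0]
  refine (Run.whileLt (fun κ s => ∃ q, κ = 8 * (k + 1 - q) + 11 * n * N q + 1 ∧ q ≤ k + 1 ∧
    s.reg 8 = i ∧ s.reg 9 = q ∧
    SearchInv m n M k g L (h + 1) A (Treated g h A i q 0) s) ?_ ?_ _ s
    ⟨0, rfl, by omega, h8, h9, hs⟩).mono ?_
  · rintro κ s ⟨q, rfl, -⟩
    omega
  · rintro κ s ⟨q, rfl, hq, h8, h9, hs⟩ hlt
    rw [h9, hs.base.r5] at hlt
    have hst := hNstep q hlt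
    refine Run.seq (Run.load ?_)
    rw [h9, hs.a1]
    have hs₁ := hs.setReg (x := 12) (by omega) (g q)
    generalize hs₁e : s.setReg 12 (g q) = s₁ at hs₁ ⊢
    have f8 : s₁.reg 8 = i := by rw [← hs₁e]; simp [State.reg_setReg, h8]
    have f9 : s₁.reg 9 = q := by rw [← hs₁e]; simp [State.reg_setReg, h9]
    have f12 : s₁.reg 12 = g q := by rw [← hs₁e]; simp [State.reg_setReg]
    clear hs₁e hs h8 h9 s
    have next : ∀ t s', t + 2 ≤ 8 + (11 * n * N q - 11 * n * N (q + 1)) →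
        SearchInv m n M k g L (h + 1) A (Treated g h A i (q + 1) 0) s' →
        s'.reg 8 = i → s'.reg 9 = q →
        Run W (.add 9 9 3) s' fun t' s'' => ∃ κ', (∃ q, κ' = 8 * (k + 1 - q) + 11 * n * N q + 1 ∧
          q ≤ k + 1 ∧ s''.reg 8 = i ∧ s''.reg 9 = q ∧
          SearchInv m n M k g L (h + 1) A (Treated g h A i q 0) s'') ∧
          t + t' + 1 + κ' ≤ 8 * (k + 1 - q) + 11 * n * N q + 1 := by
      intro t s' ht hs' e8 e9
      have hle : 11 * n * N (q + 1) ≤ 11 * n * N q := Nat.mul_le_mul_left _ (by omega)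
      have := hs'.base.r3
      refine Run.add (by omega) ⟨_, ⟨q + 1, rfl, by omega, ?_, ?_, hs'.setReg (by omega) _⟩,
        by omega⟩
      · simpa [State.reg_setReg] using e8
      · simp [State.reg_setReg, e9, this]
    have other : g q ≠ i → SearchInv m n M k g L (h + 1) A (Treated g h A i (q + 1) 0) s₁ := by
      intro hne
      refine hs₁.imp fun q' j' _ hE hT => Or.inl ?_
      rcases hT with hT | ⟨e, hT | ⟨rfl, hT⟩⟩
      · exact Or.inl hT
      · refine Or.inr ⟨e, Or.inl ?_⟩
        have : q' ≠ q := fun h => hne (h ▸ e)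
        omega
      · have := hE.2.1; omega
    refine Run.seq (Run.ifLt (fun h1 => ?_) fun h1 => Run.ifLt (fun h2 => ?_) fun h2 => ?_)
    · rw [f12, f8] at h1
      refine Run.skip ((next 3 s₁ (by omega) (other (by omega)) f8 f9).mono ?_)
      rintro t s' ⟨κ', hI, hle⟩
      exact ⟨κ', hI, by omega⟩
    · rw [f12, f8] at h2
      refine Run.skip ((next 4 s₁ (by omega) (other (by omega)) f8 f9).mono ?_)
      rintro t s' ⟨κ', hI, hle⟩
      exact ⟨κ', hI, by omega⟩
    · rw [f12, f8] at h1 h2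
      have hgq : g q = i := by omega
      rw [if_pos hgq] at hst
      have hqn : q * n + n ≤ m * n := by
        rw [← Nat.succ_mul]; exact Nat.mul_le_mul_right n (by omega)
      refine Run.seq (Run.mul (by rw [f9, hs₁.base.r1]; omega) (Run.seq (Run.copy ?_)))
      refine (run_scanAgents hW hkm hlt hgq hi _ ((hs₁.setReg (by omega) _).setReg
        (by omega) _) ?_ ?_ ?_ ?_).mono ?_
      · simpa [State.reg_setReg] using f8
      · simpa [State.reg_setReg] using f9
      · simp [State.reg_setReg, f9, hs₁.base.r1]
      · simp [State.reg_setReg, hs₁.base.r2]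
      · rintro t s' ⟨ht, hs', e8, e9⟩
        have : 11 * n * N q = 11 * n * N (q + 1) + 11 * n := by rw [hst]; ring
        refine (next (1 + (1 + (1 + t) + 1 + 1)) s' (by omega) hs' e8 e9).mono ?_
        rintro t s' ⟨κ', hI, hle⟩
        exact ⟨κ', hI, by omega⟩
  · rintro t s' ⟨ht, ⟨κ, q, -, hq, h8, h9, hs'⟩, hlt⟩
    rw [h9, hs'.base.r5] at hlt
    obtain rfl : q = k + 1 := by omega
    exact ⟨by omega, hs'⟩

theorem run_search (hW : m * n + m + n + 2 ≤ W) (hkm : k < m) (s : State)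
    (hs : SearchInv m n M k g L 0 A (fun _ _ => False) s) :
    Run W search s fun t s' =>
      t ≤ (n + 1) * (8 * (k + 1) + 5) + 11 * n * (k + 1) + 1 ∧
      ∃ h A, SearchInv m n M k g L h A (fun q _ => ∃ x, x < s'.reg 7 ∧ s'.arr 3 x = g q) s' := by
  -- The items whose owner has not been dequeued. Since queue entries are distinct, each item pays
  -- for a scan of the agents at most once per search.
  set N : ℕ → (ℕ → ℕ) → ℕ := fun h A =>
    ((Finset.range (k + 1)).filter fun q => ∀ x, x < h → A x ≠ g q).card with hN
  have hN0 : N 0 A = k + 1 := by simp [hN]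
  -- The queue holds agent 0 and at most `n` others. The 5 covers four steps of the loop itself and
  -- the last test of `scanItems`.
  refine (Run.whileLt (fun κ s => ∃ h A, κ = (n + 1 - h) * (8 * (k + 1) + 5) + 11 * n * N h A + 1 ∧
    SearchInv m n M k g L h A (fun q _ => ∃ x, x < h ∧ A x = g q) s) ?_ ?_ _ s
    ⟨0, A, rfl, hs.imp (by rintro q j _ _ ⟨x, hx, -⟩; omega)⟩).mono ?_
  · rintro κ s ⟨h, A, rfl, -⟩
    omega
  · rintro κ s ⟨h, A, rfl, hs⟩ hlt
    rw [hs.r6] at hlt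
    have htail := hs.tree.tail_le
    have hr3 := hs.base.r3
    have hr2 := hs.base.r2
    have hr6 := hs.r6
    refine Run.seq (Run.load (Run.seq (Run.add ?_ (Run.seq (Run.copy ?_)))))
    · simp [State.reg_setReg, hr3, hr6]
      omega
    set s₁ := ((s.setReg 8 (s.arr 3 (s.reg 6))).setReg 6 ((s.setReg 8 (s.arr 3 (s.reg 6))).reg 6 +
      (s.setReg 8 (s.arr 3 (s.reg 6))).reg 3)) with hs₁e
    have e6 : s₁.reg 6 = h + 1 := by simp [hs₁e, State.reg_setReg, hr3, hr6]
    have e7 : s₁.reg 7 = s.reg 7 := by simp [hs₁e, State.reg_setReg]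
    have e2 : s₁.reg 2 = 0 := by simp [hs₁e, State.reg_setReg, hr2]
    have e8 : s₁.reg 8 = s.arr 3 h := by simp [hs₁e, State.reg_setReg, hr6]
    have harr : s₁.arr = s.arr := rfl
    have hs₁ : SearchInv m n M k g L (h + 1) (s.arr 3)
        (Treated g h (s.arr 3) (s.arr 3 h) 0 0) s₁ := by
      refine ⟨(hs.base.setReg (by omega) _).setReg (by omega) _, hs.a1, hs.a2, e6, by omega,
        fun _ _ => rfl, ?_, ?_⟩
      · rw [e7]; exact hs.tree
      · rintro q j (⟨x, hx, e⟩ | ⟨-, hq | ⟨-, hj⟩⟩) hqk hE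
        · exact hs.cov q j ⟨x, hx, by rw [← hs.pref x hx, e]⟩ hqk hE
        · omega
        · have := hE.2.1; omega
    have hNs : N h A = N (h + 1) (s.arr 3) +
        ((Finset.range (k + 1)).filter fun q => g q = s.arr 3 h).card := by
      simp only [hN]
      rw [← Finset.card_union_of_disjoint]
      · congr 1
        ext q
        simp only [Finset.mem_filter, Finset.mem_union, Finset.mem_range]
        constructor
        · rintro ⟨hq, hall⟩
          by_cases he : g q = s.arr 3 h
          · exact Or.inr ⟨hq, he⟩
          · refine Or.inl ⟨hq, fun x hx => ?_⟩
            rcases Nat.lt_succ_iff_lt_or_eq.1 hx with h1 | rfl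
            · rw [hs.pref x h1]; exact hall x h1
            · exact Ne.symm he
        · rintro (⟨hq, hall⟩ | ⟨hq, he⟩)
          · exact ⟨hq, fun x hx => by rw [← hs.pref x hx]; exact hall x (by omega)⟩
          · refine ⟨hq, fun x hx e => ?_⟩
            rw [← hs.pref x hx] at e
            have := hs.tree.inj x h (by omega) hlt (e.trans he)
            omega
      · rw [Finset.disjoint_left]
        intro q h1 h2
        simp only [Finset.mem_filter] at h1 h2
        exact h1.2 h (Nat.lt_succ_self h) h2.2.symm
    refine (run_scanItems hW hkm ⟨h, Nat.lt_succ_self h, rfl⟩ _ (hs₁.setReg (x := 9)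
      (by omega) _) ?_ ?_).mono ?_
    · simpa [State.reg_setReg] using e8
    · simpa [State.reg_setReg] using e2
    · rintro t s' ⟨ht, hs'⟩
      refine ⟨_, ⟨h + 1, s.arr 3, rfl, hs'.imp fun q j hq _ => ?_⟩, ?_⟩
      · rintro ⟨x, hx, e⟩
        rcases Nat.lt_succ_iff_lt_or_eq.1 hx with h1 | rfl
        · exact Or.inl (Or.inl ⟨x, h1, e⟩)
        · exact Or.inl (Or.inr ⟨e.symm, Or.inl hq⟩)
      · obtain ⟨r, hr⟩ : ∃ r, n + 1 - h = r + 1 := ⟨n - h, by omega⟩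
        have hr' : n + 1 - (h + 1) = r := by omega
        rw [hr, hr', hNs, Nat.add_mul r 1, Nat.mul_add (11 * n)]
        omega
  · rintro t s' ⟨ht, ⟨κ, h, A', -, hs'⟩, hlt⟩
    rw [hs'.r6] at hlt
    have hle := hs'.head_le
    have he : s'.reg 7 = h := by omega
    refine ⟨by rw [hN0] at ht; exact ht, h, A', hs'.imp fun q j _ _ => ?_⟩
    rintro ⟨x, hx, e⟩
    rw [he] at hx
    exact Or.inl ⟨x, hx, by rw [← hs'.pref x hx, e]⟩

end

/-! ### Choosing the receiver, shifting, and the main loop -/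

section

variable {W m n k T : ℕ} {M g L Q par : ℕ → ℕ}

/-- The initial candidate is agent 0 with fictitious load `m`. Every visited agent has a smaller
load, so the first one replaces it. -/
theorem run_pickLeast (hT : 1 ≤ T) (hTW : T < W) (hroot : Q 0 = 0)
    (hQ : ∀ x, 1 ≤ x → x < T → Q x ≠ 0 ∧ L (Q x) < m) (s : State) (a2 : s.arr 2 = L)
    (a3 : s.arr 3 = Q) (r3 : s.reg 3 = 1) (r7 : s.reg 7 = T) (r14 : s.reg 14 = 0)
    (r15 : s.reg 15 = m) (r16 : s.reg 16 = 1) :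
    Run W pickLeast s fun t s' => t ≤ 7 * T + 1 ∧ s'.arr = s.arr ∧
      (∀ r, r < 12 → s'.reg r = s.reg r) ∧ s'.reg 15 ≤ m ∧ (∃ y, y < T ∧ Q y = s'.reg 14) ∧
      (2 ≤ T → s'.reg 14 ≠ 0) ∧ (s'.reg 14 ≠ 0 → s'.reg 15 = L (s'.reg 14)) ∧
      ∀ y, 1 ≤ y → y < T → s'.reg 15 ≤ L (Q y) := by
  refine (Run.whileLt (fun κ s' => ∃ x, κ = 7 * (T - x) + 1 ∧ 1 ≤ x ∧ x ≤ T ∧ s'.reg 16 = x ∧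
    s'.arr = s.arr ∧ (∀ r, r < 12 → s'.reg r = s.reg r) ∧ s'.reg 15 ≤ m ∧
    (∃ y, y < T ∧ Q y = s'.reg 14) ∧ (2 ≤ x → s'.reg 14 ≠ 0) ∧
    (s'.reg 14 = 0 → s'.reg 15 = m) ∧ (s'.reg 14 ≠ 0 → s'.reg 15 = L (s'.reg 14)) ∧
    ∀ y, 1 ≤ y → y < x → s'.reg 15 ≤ L (Q y)) ?_ ?_ (7 * (T - 1) + 1) s
    ⟨1, rfl, le_rfl, hT, r16, rfl, fun _ _ => rfl, r15.le, ⟨0, hT, by rw [hroot, r14]⟩,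
      by omega, fun _ => r15, fun h => absurd r14 h, by omega⟩).mono ?_
  · rintro κ s ⟨x, rfl, -⟩
    omega
  · rintro κ s' ⟨x, rfl, hx1, hxT, e16, harr, hreg, hm, hw, hne, hb0, hb, hmin⟩ hlt
    have e7 : s'.reg 7 = T := (hreg 7 (by omega)).trans r7
    have e3 : s'.reg 3 = 1 := (hreg 3 (by omega)).trans r3
    rw [e16, e7] at hlt
    obtain ⟨hQ0, hQm⟩ := hQ x hx1 hlt
    refine Run.seq (Run.load (Run.seq (Run.load ?_)))
    rw [State.arr_setReg, State.reg_setReg, if_pos rfl, e16, harr, a3, a2]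
    refine Run.seq (Run.ifLt (fun hc => ?_) fun hc => ?_)
    · have hc' : L (Q x) < s'.reg 15 := by simpa [State.reg_setReg] using hc
      refine Run.seq (Run.copy (Run.copy (Run.add ?_ ⟨_, ⟨x + 1, rfl, by omega, by omega, ?_,
        by simpa [State.arr_setReg] using harr, fun r hr => ?_, ?_, ⟨x, hlt, ?_⟩, fun _ => ?_,
        fun h => ?_, fun _ => ?_, fun y hy1 hy2 => ?_⟩, by omega⟩)))
      · simp [State.reg_setReg, e16, e3]; omega
      · simp [State.reg_setReg, e16, e3]
      · simp only [State.reg_setReg]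
        rw [if_neg (by omega), if_neg (by omega), if_neg (by omega), if_neg (by omega),
          if_neg (by omega), hreg r hr]
      · simp [State.reg_setReg]; omega
      · simp [State.reg_setReg]
      · simpa [State.reg_setReg] using hQ0
      · simp [State.reg_setReg] at h; exact absurd h hQ0
      · simp [State.reg_setReg]
      · simp [State.reg_setReg]
        rcases Nat.lt_succ_iff_lt_or_eq.1 hy2 with h1 | rfl
        · exact hc'.le.trans (hmin y hy1 h1)
        · exact le_rfl
    · have hc' : ¬ L (Q x) < s'.reg 15 := by simpa [State.reg_setReg] using hc
      have hw0 : s'.reg 14 ≠ 0 := fun h => hc' (by rw [hb0 h]; exact hQm)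
      refine Run.skip (Run.add ?_ ⟨_, ⟨x + 1, rfl, by omega, by omega, ?_,
        by simpa [State.arr_setReg] using harr, fun r hr => ?_, ?_, ?_, fun _ => ?_,
        fun h => ?_, fun _ => ?_, fun y hy1 hy2 => ?_⟩, by omega⟩)
      · simp [State.reg_setReg, e16, e3]; omega
      · simp [State.reg_setReg, e16, e3]
      · simp only [State.reg_setReg]
        rw [if_neg (by omega), if_neg (by omega), if_neg (by omega), hreg r hr]
      · simpa [State.reg_setReg] using hm
      · simpa [State.reg_setReg] using hw
      · simpa [State.reg_setReg] using hw0
      · simp [State.reg_setReg] at h; exact absurd h hw0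
      · simpa [State.reg_setReg] using hb hw0
      · simp [State.reg_setReg]
        rcases Nat.lt_succ_iff_lt_or_eq.1 hy2 with h1 | rfl
        · exact hmin y hy1 h1
        · omega
  · rintro t s' ⟨ht, ⟨κ, x, -, hx1, hxT, e16, harr, hreg, hm, hw, hne, -, hb, hmin⟩, hlt⟩
    rw [e16, hreg 7 (by omega), r7] at hlt
    obtain rfl : x = T := by omega
    exact ⟨by omega, harr, hreg, hm, hw, hne, hb, hmin⟩

/-- The queue position strictly decreases from an agent to its tree parent, so it bounds the number
of rounds, each of 5 steps. -/
theorem run_shiftPath {E : ℕ → ℕ → Prop} {vis : ℕ → ℕ} {w x : ℕ} (hg : PartialStable m E k g)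
    (ht : SearchTree n E g (k + 1) T Q par vis) (hE : ∀ q j, E q j → q < m) (s : State)
    (r2 : s.reg 2 = 0) (r14 : s.reg 14 = Q x) (a4 : s.arr 4 = par)
    (h : PathShift m E g k T Q w x (s.arr 1)) :
    Run W shiftPath s fun t s' => t ≤ 5 * x + 1 ∧ (∀ a, a ≠ 1 → s'.arr a = s.arr a) ∧
      (∀ r, r < 12 → s'.reg r = s.reg r) ∧
      ∃ y, Q y = 0 ∧ PathShift m E g k T Q w y (s'.arr 1) := by
  refine (Run.whileLt (fun κ s' => ∃ y, κ = 5 * y + 1 ∧ s'.reg 14 = Q y ∧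
    (∀ a, a ≠ 1 → s'.arr a = s.arr a) ∧ (∀ r, r < 12 → s'.reg r = s.reg r) ∧
    PathShift m E g k T Q w y (s'.arr 1)) ?_ ?_ (5 * x + 1) s
    ⟨x, rfl, r14, fun _ _ => rfl, fun _ _ => rfl, h⟩).mono ?_
  · rintro κ s ⟨x, rfl, -⟩
    omega
  · rintro κ s' ⟨y, rfl, e14, harr, hreg, h⟩ hlt
    rw [hreg 2 (by omega), r2, e14] at hlt
    obtain ⟨z, hz, hgz, h'⟩ := h.step hg ht hE (by omega)
    refine Run.seq (Run.load (Run.seq (Run.load (Run.seq (Run.store (Run.copy ?_))))))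
    refine ⟨_, ⟨z, rfl, ?_, fun a ha => ?_, fun r hr => ?_, ?_⟩, by omega⟩
    · simp [State.reg_setReg, State.reg_setArr, State.arr_setReg, harr 4, a4, e14, hgz]
    · rw [State.arr_setReg, State.arr_setArr, if_neg ha]
      exact harr a ha
    · simp only [State.reg_setReg, State.reg_setArr]
      rw [if_neg (by omega), if_neg (by omega), if_neg (by omega), hreg r hr]
    · simpa [State.reg_setReg, State.reg_setArr, State.arr_setReg, State.arr_setArr, harr 4, a4,
        e14] using h'
  · rintro t s' ⟨ht, ⟨κ, y, -, e14, harr, hreg, h⟩, hlt⟩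
    rw [hreg 2 (by omega), r2, e14] at hlt
    exact ⟨ht, harr, hreg, y, by omega, h⟩

/-- The invariant of the main loop. -/
structure MainInv (m n : ℕ) (M : ℕ → ℕ) (k : ℕ) (s : State) : Prop where
  r0 : s.reg 0 = m
  r1 : s.reg 1 = n
  r2 : s.reg 2 = 0
  r3 : s.reg 3 = 1
  r4 : s.reg 4 = k
  a0 : s.arr 0 = M
  stable : PartialStable m (Wants m n M) k (s.arr 1)
  load : ∀ j, j ≠ 0 → s.arr 2 j = loadOf m (s.arr 1) j
  vis : ∀ j, s.arr 5 j ≤ k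

theorem run_insertItem (hW : m * n + m + n + 2 ≤ W) (hn : 1 ≤ n) (hkm : k < m) (s : State)
    (hs : MainInv m n M k s) :
    Run W insertItem s fun t s' => t + 1 ≤ 70 * (m * n) ∧ MainInv m n M (k + 1) s' := by
  obtain ⟨r0, r1, r2, r3, r4, a0, hg, hl, hv⟩ := hs
  refine Run.seq (Run.add (by omega) (Run.seq (Run.store (Run.seq (Run.copy
    (Run.seq (Run.copy (Run.seq ?_))))))))
  have hinit : SearchInv m n M k (s.arr 1) (s.arr 2) 0 (fun _ => 0) (fun _ _ => False)
      (((((s.setReg 5 (s.reg 4 + s.reg 3)).setArr 3 0 0).setReg 6 0).setReg 7 1)) := by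
    constructor
    · constructor <;> simp [State.reg_setReg, State.reg_setArr, State.arr_setReg,
        State.arr_setArr, r0, r1, r2, r3, r4, a0]
    · simp [State.arr_setReg, State.arr_setArr]
    · simp [State.arr_setReg, State.arr_setArr]
    · simp [State.reg_setReg]
    · exact Nat.zero_le _
    · intro x hx; omega
    · have : (((((s.setReg 5 (s.reg 4 + s.reg 3)).setArr 3 0 0).setReg 6 0).setReg 7 1)).reg 7 = 1 := by
        simp [State.reg_setReg]
      rw [this]
      refine SearchTree.init ?_ ?_
      · simp [State.arr_setReg, State.arr_setArr]
      · simpa [State.arr_setReg, State.arr_setArr] using hv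
    · intro q j h; exact h.elim
  -- Registers 2 and 3 serve as the constants 0 and 1.
  have hstate : ((((s.setReg 5 (s.reg 4 + s.reg 3)).setArr 3
      ((s.setReg 5 (s.reg 4 + s.reg 3)).reg 2) ((s.setReg 5 (s.reg 4 + s.reg 3)).reg 2)).setReg 6
      (((s.setReg 5 (s.reg 4 + s.reg 3)).setArr 3
      ((s.setReg 5 (s.reg 4 + s.reg 3)).reg 2) ((s.setReg 5 (s.reg 4 + s.reg 3)).reg 2)).reg 2)).setReg 7
      ((((s.setReg 5 (s.reg 4 + s.reg 3)).setArr 3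
      ((s.setReg 5 (s.reg 4 + s.reg 3)).reg 2) ((s.setReg 5 (s.reg 4 + s.reg 3)).reg 2)).setReg 6
      (((s.setReg 5 (s.reg 4 + s.reg 3)).setArr 3
      ((s.setReg 5 (s.reg 4 + s.reg 3)).reg 2) ((s.setReg 5 (s.reg 4 + s.reg 3)).reg 2)).reg 2)).reg 3)) =
      (((((s.setReg 5 (s.reg 4 + s.reg 3)).setArr 3 0 0).setReg 6 0).setReg 7 1)) := by
    simp [State.reg_setReg, State.reg_setArr, r2, r3]
  rw [hstate]
  refine (run_search hW hkm _ hinit).mono ?_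
  rintro t₁ s₁ ⟨ht₁, h, A, hs₁⟩
  generalize hgdef : s.arr 1 = g at *
  generalize hLdef : s.arr 2 = L at *
  clear hinit hstate
  have htail := hs₁.tree.tail_le
  have hTpos := hs₁.tree.pos
  -- The queue is exhausted, so the visited agents are closed: whoever values an item of a queue
  -- entry is marked.
  have hcl : ∀ y, y < s₁.reg 7 → ∀ q, q < k + 1 → g q = s₁.arr 3 y → ∀ j, Wants m n M q j →
      s₁.arr 5 j = k + 1 := fun y hy q hq e j hE => hs₁.cov q j ⟨y, hy, e.symm⟩ hq hE
  have hlk : ∀ j, j ≠ 0 → loadOf m g j ≤ k := fun j hj => loadOf_le hg.lt hj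
  refine Run.seq (Run.copy (Run.seq (Run.copy (Run.seq (Run.copy (Run.seq ?_))))))
  refine (run_pickLeast (m := m) (Q := s₁.arr 3) (L := L) (T := s₁.reg 7) hTpos (by omega)
    hs₁.tree.root (fun x h1 h2 => ?_) _ ?_ ?_ ?_ ?_ ?_ ?_ ?_).mono ?_
  · have h0 : s₁.arr 3 x ≠ 0 := by have := hs₁.tree.range x h1 h2; omega
    refine ⟨h0, ?_⟩
    rw [hl _ h0]
    exact (hlk _ h0).trans_lt hkm
  · simpa [State.arr_setReg] using hs₁.a2
  · simp [State.arr_setReg]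
  · simpa [State.reg_setReg] using hs₁.base.r3
  · simp [State.reg_setReg]
  · simpa [State.reg_setReg] using hs₁.base.r2
  · simpa [State.reg_setReg] using hs₁.base.r0
  · simpa [State.reg_setReg] using hs₁.base.r3
  rintro t₂ s₂ ⟨ht₂, harr, hreg, hbm, ⟨x, hx, hxw⟩, hw0, hbw, hmin⟩
  simp only [State.arr_setReg] at harr
  have hreg' : ∀ r, r < 12 → s₂.reg r = s₁.reg r := by
    intro r hr
    rw [hreg r hr]
    simp only [State.reg_setReg]
    rw [if_neg (by omega), if_neg (by omega), if_neg (by omega)]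
  have e3 : s₂.reg 3 = 1 := (hreg' 3 (by omega)).trans hs₁.base.r3
  -- If no agent was visited, this writes `m + 1` at index 0 of the loads, which is harmless because
  -- loads are tracked for `j ≠ 0` only.
  refine Run.seq (Run.add (by rw [e3]; omega) (Run.seq (Run.store (Run.seq ?_))))
  have hshift : PathShift m (Wants m n M) g k (s₁.reg 7) (s₁.arr 3) (s₁.arr 3 x) x g :=
    PathShift.init hx
  refine (run_shiftPath (g := g) (Q := s₁.arr 3) (T := s₁.reg 7) (par := s₁.arr 4)
    (vis := s₁.arr 5) (w := s₁.arr 3 x) (x := x) hg hs₁.tree (fun q j hE => hE.1) _ ?_ ?_ ?_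
    ?_).mono ?_
  · simpa [State.reg_setReg, State.reg_setArr] using (hreg' 2 (by omega)).trans hs₁.base.r2
  · simpa [State.reg_setReg, State.reg_setArr] using hxw.symm
  · simp [State.arr_setReg, State.arr_setArr, harr]
  · simpa [State.arr_setReg, State.arr_setArr, harr, hs₁.a1] using hshift
  rintro t₃ s₃ ⟨ht₃, harr₃, hreg₃, y, hy0, hps⟩
  have hreg₃' : ∀ r, r < 12 → s₃.reg r = s₁.reg r := by
    intro r hr
    rw [hreg₃ r hr, State.reg_setArr, State.reg_setReg, if_neg (by omega), hreg' r hr]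
  have hfin : PartialStable m (Wants m n M) (k + 1) (s₃.arr 1) := by
    refine hps.partialStable hg hs₁.tree hcl (fun hT => hxw ▸ hw0 hT) ⟨x, hx, rfl⟩
      (fun z hz1 hz2 => ?_) hy0
    have h0 : s₁.arr 3 z ≠ 0 := by have := hs₁.tree.range z hz1 hz2; omega
    have hw := hw0 (by omega)
    rw [hxw, ← hl _ hw, ← hbw hw, ← hl _ h0]
    exact hmin z hz1 hz2
  refine Run.copy ⟨?_, ?_, ?_, ?_, ?_, ?_, ?_, ?_, ?_, ?_⟩
  -- The search contributes 26 and 11, the linear parts of `pickLeast` and `shiftPath` 7 and 5, and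
  -- constants with the main loop's test 21, in units of `m * n`.
  · have h1 : m ≤ m * n := Nat.le_mul_of_pos_right m hn
    have h2 : n ≤ m * n := Nat.le_mul_of_pos_left n (by omega)
    have h3 : (n + 1) * (8 * (k + 1) + 5) ≤ 26 * (m * n) := by
      calc (n + 1) * (8 * (k + 1) + 5) ≤ (2 * n) * (13 * m) :=
            Nat.mul_le_mul (by omega) (by omega)
        _ = 26 * (m * n) := by ring
    have h4 : 11 * n * (k + 1) ≤ 11 * (m * n) := by
      calc 11 * n * (k + 1) ≤ 11 * n * m := Nat.mul_le_mul_left _ (by omega)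
        _ = 11 * (m * n) := by ring
    omega
  · simpa [State.reg_setReg] using (hreg₃' 0 (by omega)).trans hs₁.base.r0
  · simpa [State.reg_setReg] using (hreg₃' 1 (by omega)).trans hs₁.base.r1
  · simpa [State.reg_setReg] using (hreg₃' 2 (by omega)).trans hs₁.base.r2
  · simpa [State.reg_setReg] using (hreg₃' 3 (by omega)).trans hs₁.base.r3
  · simpa [State.reg_setReg] using (hreg₃' 5 (by omega)).trans hs₁.base.r5
  · rw [State.arr_setReg, harr₃ 0 (by omega)]
    simpa [State.arr_setReg, State.arr_setArr, harr] using hs₁.base.a0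
  · exact hfin
  · intro j hj
    rw [State.arr_setReg, harr₃ 2 (by omega)]
    have hlj := hps.load j
    rw [hy0, if_neg hj, hxw] at hlj
    have e2 : s₂.arr 2 = L := by rw [harr]; exact hs₁.a2
    simp only [State.arr_setArr, if_true, State.arr_setReg, State.reg_setReg, e2, e3]
    by_cases hjw : j = s₂.reg 14
    · subst hjw
      rw [if_pos rfl] at hlj
      simp only [show (14 : ℕ) ≠ 15 by omega, if_false, Function.update_self]
      rw [hbw hj, hl _ hj]
      omega
    · rw [if_neg hjw] at hlj
      simp only [show (14 : ℕ) ≠ 15 by omega, if_false, Function.update_of_ne hjw]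
      rw [hl _ hj]
      omega
  · intro j
    rw [State.arr_setReg, harr₃ 5 (by omega)]
    simpa [State.arr_setReg, State.arr_setArr, harr] using hs₁.tree.vis_le j

theorem run_stableProg (hW : m * n + m + n + 2 ≤ W) (hn : 1 ≤ n) (s : State)
    (r0 : s.reg 0 = m) (r1 : s.reg 1 = n) (hr : ∀ r, 2 ≤ r → s.reg r = 0)
    (ha : ∀ a, 1 ≤ a → s.arr a = fun _ => 0) :
    Run W stableProg s fun t s' => t ≤ 70 * (m * n) * m + 2 ∧
      PartialStable m (Wants m n (s.arr 0)) m (s'.arr 1) := by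
  refine Run.seq (Run.const (by omega) ?_)
  refine (Run.whileLt (fun κ s' => ∃ k, κ = 70 * (m * n) * (m - k) + 1 ∧ k ≤ m ∧
    MainInv m n (s.arr 0) k s') ?_ ?_ (70 * (m * n) * (m - 0) + 1) _ ⟨0, rfl, by omega, ?_⟩).mono ?_
  · rintro κ s ⟨k, rfl, -⟩
    omega
  · rintro κ s' ⟨k, rfl, hk, hs'⟩ hlt
    rw [hs'.r4, hs'.r0] at hlt
    refine (run_insertItem hW hn hlt s' hs').mono ?_
    rintro t s'' ⟨ht, hs''⟩
    obtain ⟨r, hr⟩ : ∃ r, m - k = r + 1 := ⟨m - k - 1, by omega⟩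
    refine ⟨_, ⟨k + 1, rfl, hlt, hs''⟩, ?_⟩
    rw [hr, show m - (k + 1) = r by omega, Nat.mul_succ]
    omega
  · constructor
    · simpa [State.reg_setReg] using r0
    · simpa [State.reg_setReg] using r1
    · simpa [State.reg_setReg] using hr 2 le_rfl
    · simp [State.reg_setReg]
    · simpa [State.reg_setReg] using hr 4 (by omega)
    · rfl
    · rw [State.arr_setReg, ha 1 le_rfl]
      exact partialStable_zero m _
    · intro j hj
      rw [State.arr_setReg, ha 1 le_rfl, ha 2 (by omega)]
      simp [loadOf, hj.symm]
    · intro j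
      rw [State.arr_setReg, ha 5 (by omega)]
  · rintro t s' ⟨ht, ⟨κ, k, -, hk, hs'⟩, hlt⟩
    rw [hs'.r4, hs'.r0] at hlt
    obtain rfl : k = m := by omega
    exact ⟨by rw [Nat.sub_zero] at ht; omega, hs'.stable⟩

end

/-! ### Reading off the allocation -/

/-- The allocation that gives item `o` to agent `i` if `g o = i + 1`. -/
def Allocation.ofAssignment (m n : ℕ) (g : ℕ → ℕ) : Allocation m n where
  bundle i := Finset.univ.filter fun o : Fin m => g o = i + 1
  disjoint i j hij := by
    rw [Finset.disjoint_left]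
    intro o hi hj
    simp only [Finset.mem_filter, Finset.mem_univ, true_and] at hi hj
    exact hij (Fin.ext (by omega))

theorem Allocation.mem_ofAssignment {m n : ℕ} {g : ℕ → ℕ} {i : Fin n} {o : Fin m} :
    o ∈ (Allocation.ofAssignment m n g).bundle i ↔ g o = i + 1 := by
  simp [Allocation.ofAssignment]

theorem Allocation.card_ofAssignment {m n : ℕ} (g : ℕ → ℕ) (i : Fin n) :
    ((Allocation.ofAssignment m n g).bundle i).card = loadOf m g (i + 1) := by
  rw [loadOf, Finset.card_filter,
    ← Fin.sum_univ_eq_sum_range (fun q => if g q = i + 1 then 1 else 0) m, ← Finset.card_filter]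
  rfl

theorem outputs_ofAssignment {m n : ℕ} {E : ℕ → ℕ → Prop} (hE : ∀ q j, E q j → 1 ≤ j ∧ j ≤ n)
    {s : State} (hg : PartialStable m E m (s.arr 1)) :
    Outputs s (Allocation.ofAssignment m n (s.arr 1)) := by
  refine fun o => ⟨fun i hi => Allocation.mem_ofAssignment.1 hi, fun h => ?_⟩
  by_contra hne
  obtain ⟨h1, h2⟩ := hE _ _ (hg.clean o hne)
  refine h ⟨s.arr 1 o - 1, by omega⟩ (Allocation.mem_ofAssignment.2 ?_)
  simp only
  omega

theorem isStable_ofAssignment {m n : ℕ} {v : Fin n → Finset (Fin m) → ℝ}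
    (hv : ∀ i, IsBinaryAdditive (v i)) {E : ℕ → ℕ → Prop}
    (hE : ∀ q j, E q j → 1 ≤ j ∧ j ≤ n)
    (hvE : ∀ (o : Fin m) (i : Fin n), E o (i + 1) ↔ v i {o} = 1) {g : ℕ → ℕ}
    (hg : PartialStable m E m g) : IsStable v (Allocation.ofAssignment m n g) := by
  refine ⟨(isAdmissible_iff hv _).2 ⟨fun i o ho => ?_, fun o i hoi => ?_⟩,
    HasCuts.not_hasNarrowingTransfer fun t => ?_⟩
  · rw [Allocation.mem_ofAssignment] at ho
    rw [← hvE, ← ho]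
    exact hg.clean o (by omega)
  · have hne : g o ≠ 0 := fun h0 => hg.full o o.2 h0 _ ((hvE o i).2 hoi)
    obtain ⟨h1, h2⟩ := hE _ _ (hg.clean o hne)
    refine ⟨⟨g o - 1, by omega⟩, Allocation.mem_ofAssignment.2 ?_⟩
    simp only
    omega
  · classical
    obtain ⟨R, h1, h2, h3⟩ := hg.cut t
    refine ⟨Finset.univ.filter fun i : Fin n => (i : ℕ) + 1 ∈ R, fun i hi => ?_, fun i hi => ?_,
      fun i hi o ho j hj => ?_⟩
    · rw [Allocation.card_ofAssignment] at hi
      exact Finset.mem_filter.2 ⟨Finset.mem_univ _, h1 _ (by omega) hi⟩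
    · rw [Allocation.card_ofAssignment]
      exact (h2 _ (Finset.mem_filter.1 hi).2).2
    · rw [Allocation.mem_ofAssignment] at ho
      refine Finset.mem_filter.2 ⟨Finset.mem_univ _, h3 o ?_ _ ((hvE o j).2 hj)⟩
      rw [ho]
      exact (Finset.mem_filter.1 hi).2

/-- Division of the index by `n` recovers the item, since agent numbers are below `n`; so distinct
pairs occupy distinct cells. -/
theorem wants_inputState {m n : ℕ} (v : Fin n → Finset (Fin m) → ℝ) (o : Fin m) (i : Fin n) :
    Wants m n ((inputState v).arr 0) o (i + 1) ↔ v i {o} = 1 := by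
  have hn : 0 < n := i.pos
  simp only [Wants, inputState, true_and, Nat.add_sub_cancel]
  constructor
  · rintro ⟨-, -, -, h⟩
    split_ifs at h with hex
    · obtain ⟨o', i', e, hval⟩ := hex
      have ho : (o : ℕ) = o' := by
        have := congrArg (· / n) e
        simpa [Nat.mul_comm _ n, Nat.mul_add_div hn, Nat.div_eq_of_lt] using this
      have hi : (i : ℕ) = i' := by rw [ho] at e; omega
      rwa [Fin.ext ho, Fin.ext hi]
    · exact absurd h (lt_irrefl 0)
  · intro h
    refine ⟨o.2, by omega, i.2, ?_⟩
    rw [if_pos ⟨o, i, rfl, h⟩]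
    exact Nat.one_pos

end FairAlloc

/-! ### The main theorem -/

theorem mainTheorem1 :
    (∀ (m n : ℕ) (v : Fin n → Finset (Fin m) → ℝ), (∀ i, FairAlloc.IsBinaryAdditive (v i)) →
      ∀ f : FairAlloc.Profile m n → ℝ, FairAlloc.IsSymmetricCriterion f → FairAlloc.IsSPD f →
        {χ : FairAlloc.Allocation m n | FairAlloc.IsOptimal v f χ} =
          {χ : FairAlloc.Allocation m n | FairAlloc.IsStable v χ}) ∧
    (∃ (prog : FairAlloc.Prog) (C c : ℕ), ∀ (m n : ℕ), 1 ≤ m → 1 ≤ n →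
      ∀ v : Fin n → Finset (Fin m) → ℝ, (∀ i, FairAlloc.IsBinaryAdditive (v i)) →
        ∃ (t : ℕ) (s : FairAlloc.State),
          FairAlloc.Exec ((m + n) ^ c) prog (FairAlloc.inputState v) t s ∧
          t ≤ C * (m ^ 2 * n) ∧
          ∃ χ : FairAlloc.Allocation m n, FairAlloc.Outputs s χ ∧ FairAlloc.IsStable v χ ∧
            FairAlloc.IsOptimal v FairAlloc.congestion χ) := by
  refine ⟨fun m n v hv f hsymm hspd => Set.ext fun χ =>
    FairAlloc.isOptimal_iff_isStable hv hsymm hspd χ, FairAlloc.stableProg, 72, 3,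
    fun m n hm hn v hv => ?_⟩
  -- Exponent 2 would fail at `m = n = 1`, where the left side is 5.
  have hW : m * n + m + n + 2 ≤ (m + n) ^ 3 := by
    obtain ⟨a, rfl⟩ := Nat.exists_eq_add_of_le hm
    obtain ⟨b, rfl⟩ := Nat.exists_eq_add_of_le hn
    ring_nf
    nlinarith [Nat.zero_le (a * b), Nat.zero_le (a ^ 2), Nat.zero_le (b ^ 2),
      Nat.zero_le (a ^ 2 * b), Nat.zero_le (a * b ^ 2), Nat.zero_le (a ^ 3), Nat.zero_le (b ^ 3)]
  obtain ⟨t, s, hexec, ht, hs⟩ := FairAlloc.run_stableProg hW hn (FairAlloc.inputState v)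
    rfl rfl (fun r hr => by
      simp only [FairAlloc.inputState]
      rw [if_neg (by omega), if_neg (by omega)])
    (fun a ha => by
      funext k
      exact if_neg fun h => by omega)
  have hE : ∀ q j, FairAlloc.Wants m n ((FairAlloc.inputState v).arr 0) q j → 1 ≤ j ∧ j ≤ n :=
    fun q j h => ⟨h.2.1, h.2.2.1⟩
  have hstable := FairAlloc.isStable_ofAssignment hv hE (FairAlloc.wants_inputState v) hs
  refine ⟨t, s, hexec, ht.trans ?_, _, FairAlloc.outputs_ofAssignment hE hs, hstable,
    (FairAlloc.isOptimal_iff_isStable hv FairAlloc.isSymmetricCriterion_congestion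
      FairAlloc.isSPD_congestion _).2 hstable⟩
  have h1 : 1 ≤ m ^ 2 * n := Nat.mul_pos (pow_pos hm 2) hn
  -- The two extra steps, the initial constant and the last loop test, raise 70 to 72.
  calc 70 * (m * n) * m + 2 ≤ 70 * (m ^ 2 * n) + 2 * (m ^ 2 * n) := by
        have : 70 * (m * n) * m = 70 * (m ^ 2 * n) := by ring
        omega
    _ = 72 * (m ^ 2 * n) := by ring
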